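/- Let $M$ be a smooth manifold of dimension $n$, let $A^k(M)=\Gamma(\wedge^kTM)$ (with $A^{-1}(M)=0$), and let $\mathcal A(M)=\bigoplus_{k\ge 0}A^k(M)$ be the algebra of multivector fields, with $A^0(M)=C^\infty(M)$. For $X\in A^k(M)$ and $f\in C^\infty(M)$, let $[X,f]\in A^{k-1}(M)$ be the Schouten–Nijenhuis bracket; thus $[X_1\wedge\cdots\wedge X_k,f]=\sum_j(-1)^{k-j}X_j(f)\,X_1\wedge\cdots\widehat{X_j}\cdots\wedge X_k$. A higher connection on $M$ is a map $\nabla:\mathcal A(M)\times\mathcal A(M)\to\mathcal A(M)$, $(X,Y)\mapsto\nabla_XY$, such that (i) $\nabla_XY\in A^{k+l-1}(M)$ for $X\in A^k(M)$, $Y\in A^l(M)$; (ii) $\nabla_{fX+X'}Y=f\nabla_XY+\nabla_{X'}Y$; (iii) $\nabla_X(Y+Y')=\nabla_XY+\nabla_XY'$; (iv) $\nabla_Xf=[X,f]$ for $X\in A^k(M)$, $f\in C^\infty(M)$; (v) $\nabla_X(fY)=[X,f]\wedge Y+f\nabla_XY$ for $X\in A^k(M)$, $f\in C^\infty(M)$;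 (vi) $\nabla_fX=0$ for $f\in C^\infty(M)$. It is called induced if $$\nabla_{X\wedge Y}Z=X\wedge\nabla_YZ+(-1)^{kl}\,Y\wedge\nabla_XZ,\qquad \nabla_X(Y\wedge Z)=(\nabla_XY)\wedge Z+(-1)^{(k-1)l}\,Y\wedge\nabla_XZ$$ for all $k,l\ge 0$, $X\in A^k(M)$, $Y\in A^l(M)$, $Z\in\mathcal A(M)$. An induced higher connection is said to be induced by an affine connection $\widetilde\nabla$ on $TM$ if it restricts to $\widetilde\nabla$ on vector fields; it is then also denoted $\widetilde\nabla$. Theorem. Let $\nabla$ be a higher connection on $M$. There is a unique pair $(\widetilde\nabla,\{F^{k,l}\})$, consisting of an affine connection $\widetilde\nabla$ on $TM$ and smooth sections $F^{k,l}$ of $\wedge^{k+l-1}TM\otimes\wedge^kT^*M\otimes\wedge^lT^*M$ for $k,l>0$ with $k+l-1\le n$, $F^{1,1}\equiv0$, such that $$\nabla_XY=\widetilde\nabla_XY+F^{k,l}(X,Y)$$ for all such $k,l$ and all $X\in A^k(M)$, $Y\in A^l(M)$, where $\widetilde\nabla_XY$ is taken with respect to a higher connection induced by the affine connection $\widetilde\nabla$.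 For this pair, $\nabla$ is induced if and only if $F^{k,l}\equiv 0$ for all $k,l$ (that is, all twist fields vanish). -/

import Mathlib

open scoped Manifold ContDiff

noncomputable section

namespace HigherConn

/-- The model space `ℝⁿ`. -/
abbrev Model (n : ℕ) : Type := EuclideanSpace ℝ (Fin n)

section Fields

variable (n : ℕ) (M : Type*) [TopologicalSpace M] [ChartedSpace (Model n) M]

/-- The ring `C^∞(M)`. -/
abbrev SmoothFun : Type _ := C^∞⟮𝓡 n, M; ℝ⟯

/-- All (not necessarily smooth) sections of the bundle `⋀^• TM`, with the pointwise operations;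
the product is the wedge product. -/
abbrev RawField : Type _ := Π x : M, ExteriorAlgebra ℝ (TangentSpace (𝓡 n) x)

variable {n M}

/-- The multivector `X x`, for `x` near `x₀`, read in the exterior algebra of `ℝⁿ` through the
trivialization of `TM` around `x₀`. -/
def coord [IsManifold (𝓡 n) ∞ M] (X : RawField n M) (x₀ x : M) : ExteriorAlgebra ℝ (Model n) :=
  ExteriorAlgebra.map
    ((trivializationAt (Model n) (TangentSpace (𝓡 n) : M → Type _) x₀).continuousLinearMapAt
      ℝ x).toLinearMap (X x)

/-- A section of `⋀^• TM` is smooth if, around each point and in the trivialization there, its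
components (that is, the values of all linear functionals of the finite-dimensional space
`⋀^• ℝⁿ`) are smooth functions. -/
def IsSmooth [IsManifold (𝓡 n) ∞ M] (X : RawField n M) : Prop :=
  ∀ (x₀ : M) (φ : Module.Dual ℝ (ExteriorAlgebra ℝ (Model n))),
    ContMDiffAt (𝓡 n) 𝓘(ℝ, ℝ) ∞ (fun x => φ (coord X x₀ x)) x₀

theorem isSmooth_mul [IsManifold (𝓡 n) ∞ M] {X Y : RawField n M}
    (hX : IsSmooth X) (hY : IsSmooth Y) : IsSmooth (X * Y) := by
  intro x₀ φ
  let b := ((EuclideanSpace.basisFun (Fin n) ℝ).toBasis).ExteriorAlgebra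
  have key : (fun x => φ (coord (X * Y) x₀ x)) = fun x => ∑ s, ∑ t,
      (b.coord s (coord X x₀ x) * b.coord t (coord Y x₀ x)) * φ (b s * b t) := by
    funext x
    have h : coord (X * Y) x₀ x = coord X x₀ x * coord Y x₀ x := by simp [coord]
    rw [h]
    conv_lhs => rw [← b.sum_repr (coord X x₀ x), ← b.sum_repr (coord Y x₀ x)]
    simp only [Finset.sum_mul_sum, map_sum, smul_mul_smul_comm, map_smul, smul_eq_mul,
      Module.Basis.coord_apply]
  rw [key]
  refine ContMDiffAt.sum fun s _ => ContMDiffAt.sum fun t _ => ?_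
  exact ((hX x₀ _).mul (hY x₀ _)).mul contMDiffAt_const

theorem isSmooth_add [IsManifold (𝓡 n) ∞ M] {X Y : RawField n M}
    (hX : IsSmooth X) (hY : IsSmooth Y) : IsSmooth (X + Y) := by
  intro x₀ φ
  have h : (fun x => φ (coord (X + Y) x₀ x)) =
      fun x => φ (coord X x₀ x) + φ (coord Y x₀ x) := by
    funext x; simp [coord]
  rw [h]
  exact (hX x₀ φ).add (hY x₀ φ)

/-- A function, seen as a field of multivectors of degree `0`. -/
def rawOfFun (f : M → ℝ) : RawField n M := fun x => algebraMap ℝ _ (f x)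

theorem isSmooth_rawOfFun [IsManifold (𝓡 n) ∞ M] {f : M → ℝ}
    (hf : ContMDiff (𝓡 n) 𝓘(ℝ, ℝ) ∞ f) : IsSmooth (rawOfFun (n := n) f) := by
  intro x₀ φ
  have h : (fun x => φ (coord (rawOfFun f) x₀ x)) = fun x => f x * φ 1 := by
    funext x
    simp [coord, rawOfFun, Algebra.algebraMap_eq_smul_one]
  rw [h]
  exact (hf x₀).mul contMDiffAt_const

variable (n M)

/-- The algebra `𝒜(M) = ⨁ₖ Aᵏ(M)` of multivector fields: the smooth sections of `⋀^• TM`, with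
the wedge product as multiplication. -/
def MVF [IsManifold (𝓡 n) ∞ M] : Subring (RawField n M) where
  carrier := {X | IsSmooth X}
  mul_mem' := isSmooth_mul
  add_mem' := isSmooth_add
  one_mem' := by
    have h : (1 : RawField n M) = rawOfFun (fun _ => (1 : ℝ)) := by
      funext x; simp [rawOfFun]
    rw [h]; exact isSmooth_rawOfFun contMDiff_const
  zero_mem' := by
    have h : (0 : RawField n M) = rawOfFun (fun _ => (0 : ℝ)) := by
      funext x; simp [rawOfFun]
    rw [h]; exact isSmooth_rawOfFun contMDiff_const
  neg_mem' := by
    intro X hX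
    have h : -X = rawOfFun (fun _ => (-1 : ℝ)) * X := by
      funext x; simp [rawOfFun]
    rw [h]; exact isSmooth_mul (isSmooth_rawOfFun contMDiff_const) hX

/-- The inclusion of `C^∞(M) = A⁰(M)` in `𝒜(M)`. -/
def ofFun [IsManifold (𝓡 n) ∞ M] : SmoothFun n M →+* MVF n M where
  toFun f := ⟨rawOfFun f, isSmooth_rawOfFun f.contMDiff⟩
  map_one' := by ext x; simp [rawOfFun]
  map_mul' f g := by ext x; simp [rawOfFun]
  map_zero' := by ext x; simp [rawOfFun]
  map_add' f g := by ext x; simp [rawOfFun]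

/-- `𝒜(M)` is an algebra over `C^∞(M)`, by pointwise multiplication. -/
instance [IsManifold (𝓡 n) ∞ M] : Algebra (SmoothFun n M) (MVF n M) :=
  (ofFun n M).toAlgebra' fun f X => by
    ext x; exact Algebra.commutes (f x) (X.1 x)

/-- The space `Aᵏ(M)` of `k`-vector fields. -/
def A [IsManifold (𝓡 n) ∞ M] (k : ℕ) : Submodule (SmoothFun n M) (MVF n M) where
  carrier := {X | ∀ x, X.1 x ∈ ⋀[ℝ]^k (TangentSpace (𝓡 n) x)}
  add_mem' hX hY x := Submodule.add_mem _ (hX x) (hY x)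
  zero_mem' x := Submodule.zero_mem _
  smul_mem' f X hX x := by
    have h : (f • X).1 x = f x • X.1 x := by
      rw [Algebra.smul_def, Algebra.smul_def]; rfl
    rw [h]
    exact Submodule.smul_mem _ _ (hX x)

/-- Smooth vector fields: smooth sections of `TM`. -/
abbrev VField [IsManifold (𝓡 n) ∞ M] : Type _ :=
  Cₛ^∞⟮𝓡 n; Model n, (TangentSpace (𝓡 n) : M → Type _)⟯

variable {n M}

/-- The product of a smooth function and a smooth vector field. -/
def fsmul [IsManifold (𝓡 n) ∞ M] (f : SmoothFun n M) (V : VField n M) : VField n M :=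
  ⟨fun x => f x • V x, f.contMDiff.smul_section V.contMDiff⟩

/-- A vector field as an element of `A¹(M)`. -/
def ofVField [IsManifold (𝓡 n) ∞ M] (V : VField n M) : MVF n M :=
  ⟨fun x => ExteriorAlgebra.ι ℝ (V x), by
    intro x₀ φ
    let e := trivializationAt (Model n) (TangentSpace (𝓡 n) : M → Type _) x₀
    have hV := (Bundle.contMDiffAt_section (IB := 𝓡 n) (n := ∞) x₀).1 (V.contMDiff x₀)
    let ψ : Model n →L[ℝ] ℝ := LinearMap.toContinuousLinearMap (φ ∘ₗ ExteriorAlgebra.ι ℝ)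
    have h2 : ContMDiffAt (𝓡 n) 𝓘(ℝ, ℝ) ∞ (fun x => ψ (e ⟨x, V x⟩).2) x₀ :=
      ψ.contMDiff.contMDiffAt.comp x₀ hV
    refine h2.congr_of_eventuallyEq ?_
    have hb : e.baseSet ∈ nhds x₀ :=
      e.open_baseSet.mem_nhds (FiberBundle.mem_baseSet_trivializationAt' x₀)
    filter_upwards [hb] with x hx
    simp only [coord, ψ, ExteriorAlgebra.map_apply_ι, LinearMap.coe_toContinuousLinearMap',
      LinearMap.comp_apply, ContinuousLinearMap.coe_coe]
    exact congrArg (fun v => φ (ExteriorAlgebra.ι ℝ v))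
      (Bundle.Trivialization.continuousLinearMapAt_apply_of_mem (R := ℝ) e hx (V x))⟩

/-- The Schouten–Nijenhuis bracket `[X, f]` of a multivector field and a function: for
`X = X₁ ∧ ⋯ ∧ Xₖ` it is `∑ⱼ (-1)^(k-j) Xⱼ(f) X₁ ∧ ⋯ X̂ⱼ ⋯ ∧ Xₖ`, that is, `(-1)^(k-1) i_{df} X`,
which is the contraction of `X` with `df` from the right. -/
def bracket [IsManifold (𝓡 n) ∞ M] (X : MVF n M) (f : SmoothFun n M) : RawField n M :=
  fun x => CliffordAlgebra.contractRight (X.1 x) (mvfderiv (𝓡 n) f x).toLinearMap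

/-- `[g, f] = 0` for functions `f`, `g`. -/
theorem bracket_ofFun [IsManifold (𝓡 n) ∞ M] (g f : SmoothFun n M) :
    bracket (ofFun n M g) f = 0 := by
  funext x
  exact CliffordAlgebra.contractRight_algebraMap _ _ _

/-- `[V, f] = V(f)` for a vector field `V`. -/
theorem bracket_ofVField [IsManifold (𝓡 n) ∞ M] (V : VField n M) (f : SmoothFun n M) :
    bracket (ofVField V) f = rawOfFun fun x => mvfderiv (𝓡 n) f x (V x) := by
  funext x
  exact CliffordAlgebra.contractRight_ι _ _ _

/-- `[X ∧ V, f] = V(f) X - [X, f] ∧ V` for a vector field `V`. -/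
theorem bracket_mul_ofVField [IsManifold (𝓡 n) ∞ M] (X : MVF n M) (V : VField n M)
    (f : SmoothFun n M) (x : M) :
    bracket (X * ofVField V) f x =
      mvfderiv (𝓡 n) f x (V x) • X.1 x - bracket X f x * (ofVField V).1 x :=
  CliffordAlgebra.contractRight_mul_ι _ _ _

end Fields

section Connections

variable (n : ℕ) (M : Type*) [TopologicalSpace M] [ChartedSpace (Model n) M]
  [IsManifold (𝓡 n) ∞ M]

/-- An affine connection on `TM`. -/
@[ext]
structure AffineConnection where
  /-- `toFun V W` is the covariant derivative of `W` along `V`. -/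
  toFun : VField n M → VField n M → VField n M
  add_left : ∀ V V' W, toFun (V + V') W = toFun V W + toFun V' W
  smul_left : ∀ f V W, toFun (fsmul f V) W = fsmul f (toFun V W)
  add_right : ∀ V W W', toFun V (W + W') = toFun V W + toFun V W'
  const_smul_right : ∀ (c : ℝ) V W, toFun V (c • W) = c • toFun V W
  leibniz : ∀ (f : SmoothFun n M) V W (x : M),
    toFun V (fsmul f W) x = mvfderiv (𝓡 n) f x (V x) • W x + f x • toFun V W x

/-- A higher affine connection on `M`. -/
@[ext]
structure HigherConnection where
  /-- `toFun X Y` is `∇_X Y`. -/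
  toFun : MVF n M → MVF n M → MVF n M
  /-- `∇_X Y ∈ A^(k+l-1)(M)`. For `k = l = 0`, where `A^(-1)(M) = 0`, see `fun_left`. -/
  degree : ∀ k l m : ℕ, m + 1 = k + l → ∀ X ∈ A n M k, ∀ Y ∈ A n M l, toFun X Y ∈ A n M m
  linear_left : ∀ (f : SmoothFun n M) X X' Y, toFun (f • X + X') Y = f • toFun X Y + toFun X' Y
  add_right : ∀ X Y Y', toFun X (Y + Y') = toFun X Y + toFun X Y'
  apply_fun : ∀ k, ∀ X ∈ A n M k, ∀ f : SmoothFun n M,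
    (toFun X (ofFun n M f)).1 = bracket X f
  leibniz : ∀ k, ∀ X ∈ A n M k, ∀ (f : SmoothFun n M) (Y : MVF n M),
    (toFun X (f • Y)).1 = bracket X f * Y.1 + (f • toFun X Y).1
  fun_left : ∀ (f : SmoothFun n M) X, toFun (ofFun n M f) X = 0

variable {n M}

/-- A higher connection is induced if it satisfies, for `X ∈ Aᵏ(M)`, `Y ∈ Aˡ(M)` and `Z ∈ 𝒜(M)`,
`∇_{X ∧ Y} Z = X ∧ ∇_Y Z + (-1)^(kl) Y ∧ ∇_X Z` and
`∇_X (Y ∧ Z) = ∇_X Y ∧ Z + (-1)^((k-1)l) Y ∧ ∇_X Z`.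
The second sign is written `(-1)^((k+1)l)`, which is the same and also correct for `k = 0`. -/
def HigherConnection.IsInduced (D : HigherConnection n M) : Prop :=
  ∀ k l : ℕ, ∀ X ∈ A n M k, ∀ Y ∈ A n M l, ∀ Z : MVF n M,
    D.toFun (X * Y) Z = X * D.toFun Y Z + (-1) ^ (k * l) * (Y * D.toFun X Z) ∧
    D.toFun X (Y * Z) = D.toFun X Y * Z + (-1) ^ ((k + 1) * l) * (Y * D.toFun X Z)

/-- The higher connection `D` is the one induced by the affine connection `c`: it is induced and
its restriction to vector fields is `c`. -/
def IsInducedBy (D : HigherConnection n M) (c : AffineConnection n M) : Prop :=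
  D.IsInduced ∧ ∀ V W : VField n M, D.toFun (ofVField V) (ofVField W) = ofVField (c.toFun V W)

variable (n M)

/-- A smooth section of `⋀ᵐ TM ⊗ ⋀ᵏ T*M ⊗ ⋀ˡ T*M`, seen as a family of bilinear maps
`⋀ᵏ TₓM × ⋀ˡ TₓM → ⋀ᵐ TₓM` that sends smooth sections to smooth sections. -/
@[ext]
structure TensorField (k l m : ℕ) where
  /-- The bilinear map at a point. -/
  toFun : ∀ x : M, ⋀[ℝ]^k (TangentSpace (𝓡 n) x) →ₗ[ℝ] ⋀[ℝ]^l (TangentSpace (𝓡 n) x) →ₗ[ℝ]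
    ⋀[ℝ]^m (TangentSpace (𝓡 n) x)
  smooth : ∀ (X : A n M k) (Y : A n M l),
    IsSmooth fun x => (toFun x ⟨X.1.1 x, X.2 x⟩ ⟨Y.1.1 x, Y.2 x⟩ :
      ExteriorAlgebra ℝ (TangentSpace (𝓡 n) x))

/-- A pair formed by an affine connection on `TM` and a collection of sections `F^{k,l}` of
`⋀^(k+l-1) TM ⊗ ⋀ᵏ T*M ⊗ ⋀ˡ T*M`, for `k, l > 0` with `k + l - 1 ≤ dim M`, such that
`F^{1,1} = 0`. -/
@[ext]
structure ConnectionData where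
  /-- The affine connection. -/
  conn : AffineConnection n M
  /-- The tensor fields `F^{k,l}`. -/
  twist : ∀ k l : ℕ, 0 < k → 0 < l → k + l - 1 ≤ n → TensorField n M k l (k + l - 1)
  twist_one_one : ∀ (h : 1 + 1 - 1 ≤ n) (x : M),
    (twist 1 1 one_pos one_pos h).toFun x = 0

variable {n M}

/-- The pair `d = (c, F)` is associated to the higher connection `N`: if `D` is the higher
connection induced by `c`, then `N_X Y = D_X Y + F^{k,l}(X, Y)` for `X ∈ Aᵏ(M)`, `Y ∈ Aˡ(M)`. -/
def IsAssociated (N : HigherConnection n M) (d : ConnectionData n M) : Prop :=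
  ∃ D : HigherConnection n M, IsInducedBy D d.conn ∧
    ∀ (k l : ℕ) (hk : 0 < k) (hl : 0 < l) (hkl : k + l - 1 ≤ n)
      (X : A n M k) (Y : A n M l) (x : M),
      (N.toFun X Y).1 x = (D.toFun X Y).1 x +
        ((d.twist k l hk hl hkl).toFun x ⟨X.1.1 x, X.2 x⟩ ⟨Y.1.1 x, Y.2 x⟩ :
          ExteriorAlgebra ℝ (TangentSpace (𝓡 n) x))

end Connections

end HigherConn

end

/-! The difference of two higher connections is tensorial in both arguments: both are
`C^∞(M)`-linear on the left, and for homogeneous `X` the bracket terms of the Leibniz rule cancel.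
Bump functions make such a difference a pointwise object, determined by its values on wedge products
of vector fields, because these locally span all multivector fields over `C^∞(M)`
(`Tensorial.eq_zero`).

Uniqueness. On wedges of vector fields the two product rules reduce an induced higher connection to
its restriction to vector fields, so that restriction determines it (`IsInduced.eq_of_vField`). As
`F^{1,1} = 0`, the affine connection of the pair is the restriction of `N`. Hence the induced
connection `D` is known, and so is `F = N - D`.

Existence. What is needed is an induced higher connection with the same restriction as `N`. Extend
the covariant derivative along each vector field to a derivation `∇_V` of the wedge product and put
`D_X Y = ∑ᵢ (X ⌊ eⁱ) ∧ ∇_{eᵢ} Y`, where `X ⌊ eⁱ` is contraction from the right with the dual basis.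
The derivation is built at a point `x` (`covDeriv`): subtract from `Y` an extension of `Y(x)` that
is multiplicative in `Y(x)`. The Leibniz rule over functions alone fixes `N_V` on the remainder,
which vanishes at `x`; on the extension one uses the algebraic derivation of `⋀ TₓM` given by the
Christoffel endomorphism.

Criterion. If `N` is induced, then `N = D` and the twists vanish. If they vanish, `N` and `D` agree
in positive degrees with `k + l - 1 ≤ n`; in the other degrees the axioms or the vanishing of `⋀^m`
for `m > n` leave no freedom (`eq_of_homogeneous`). -/

namespace ExteriorAlgebra

/-! ### Exterior algebra: right contraction, graded commutativity, derivations -/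

variable {R V : Type*} [CommRing R] [AddCommGroup V] [Module R V]

theorem ι_mem_exteriorPower_one (v : V) : ι R v ∈ ⋀[R]^1 V := by
  rw [exteriorPower, pow_one]
  exact LinearMap.mem_range_self _ v

theorem mul_mem_exteriorPower {k l : ℕ} {a b : ExteriorAlgebra R V} (ha : a ∈ ⋀[R]^k V)
    (hb : b ∈ ⋀[R]^l V) : a * b ∈ ⋀[R]^(k + l) V := by
  rw [exteriorPower, pow_add]
  exact Submodule.mul_mem_mul ha hb

/-- Induction on the elements of `⋀^(k+1) V`, multiplying by vectors on the right. -/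
@[elab_as_elim]
theorem exteriorPower_succ_induction {k : ℕ} {a : ExteriorAlgebra R V} (ha : a ∈ ⋀[R]^(k + 1) V)
    {C : ExteriorAlgebra R V → Prop} (mul : ∀ a ∈ ⋀[R]^k V, ∀ v, C (a * ι R v))
    (add : ∀ a b, C a → C b → C (a + b)) : C a := by
  rw [exteriorPower, pow_succ] at ha
  refine Submodule.mul_induction_on ha ?_ add
  rintro a ha _ ⟨v, rfl⟩
  exact mul a ha v

theorem mem_exteriorPower_zero {a : ExteriorAlgebra R V} :
    a ∈ ⋀[R]^0 V ↔ ∃ r : R, algebraMap R _ r = a := by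
  rw [exteriorPower, pow_zero, Submodule.mem_one]

theorem contractRight_eq_zero {a : ExteriorAlgebra R V} (ha : a ∈ ⋀[R]^0 V)
    (d : Module.Dual R V) : CliffordAlgebra.contractRight a d = 0 := by
  obtain ⟨r, rfl⟩ := mem_exteriorPower_zero.1 ha
  exact CliffordAlgebra.contractRight_algebraMap _ _ _

theorem contractRight_mem {k : ℕ} {a : ExteriorAlgebra R V} (ha : a ∈ ⋀[R]^(k + 1) V)
    (d : Module.Dual R V) : CliffordAlgebra.contractRight a d ∈ ⋀[R]^k V := by
  induction k generalizing a with
  | zero =>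
    refine exteriorPower_succ_induction ha (fun a ha v => ?_) (fun a b h h' => ?_)
    · have := CliffordAlgebra.contractRight_mul_ι (Q := (0 : QuadraticForm R V)) d v a
      rw [show CliffordAlgebra.contractRight (a * ι R v) d = _ from this]
      rw [contractRight_eq_zero ha, zero_mul, sub_zero]
      exact Submodule.smul_mem _ _ ha
    · rw [map_add]; exact Submodule.add_mem _ h h'
  | succ k ih =>
    refine exteriorPower_succ_induction ha (fun a ha v => ?_) (fun a b h h' => ?_)
    · have := CliffordAlgebra.contractRight_mul_ι (Q := (0 : QuadraticForm R V)) d v a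
      rw [show CliffordAlgebra.contractRight (a * ι R v) d = _ from this]
      exact Submodule.sub_mem _ (Submodule.smul_mem _ _ ha)
        (mul_mem_exteriorPower (ih ha) (ι_mem_exteriorPower_one v))
    · rw [map_add]; exact Submodule.add_mem _ h h'

/-- Acting from the right, the contraction meets `b` first and reaches `a` only after passing the
`l` factors of `b`, whence the sign. The induction peels vectors off the right end of `b`. -/
theorem contractRight_mul {l : ℕ} (a : ExteriorAlgebra R V) {b : ExteriorAlgebra R V}
    (hb : b ∈ ⋀[R]^l V) (d : Module.Dual R V) :
    CliffordAlgebra.contractRight (a * b) d =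
      a * CliffordAlgebra.contractRight b d +
        (-1) ^ l * (CliffordAlgebra.contractRight a d * b) := by
  induction l generalizing b with
  | zero =>
    obtain ⟨r, rfl⟩ := mem_exteriorPower_zero.1 hb
    rw [contractRight_eq_zero hb]
    simpa using CliffordAlgebra.contractRight_mul_algebraMap d a r
  | succ l ih =>
    refine exteriorPower_succ_induction hb (fun b hb v => ?_) (fun b b' h h' => ?_)
    · have h1 := CliffordAlgebra.contractRight_mul_ι (Q := (0 : QuadraticForm R V)) d v (a * b)
      have h2 := CliffordAlgebra.contractRight_mul_ι (Q := (0 : QuadraticForm R V)) d v b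
      rw [← mul_assoc, show CliffordAlgebra.contractRight (a * b * ι R v) d = _ from h1,
        show CliffordAlgebra.contractRight (b * ι R v) d = _ from h2, ih hb]
      simp only [pow_succ, mul_neg, mul_one, neg_mul, mul_sub, add_mul, mul_smul_comm, mul_assoc]
      abel_nf
    · rw [mul_add, map_add, LinearMap.add_apply, h, h', map_add, LinearMap.add_apply]
      simp only [mul_add]
      abel

theorem neg_one_pow_mul_comm (k : ℕ) (a b : ExteriorAlgebra R V) :
    a * ((-1) ^ k * b) = (-1) ^ k * (a * b) := by
  rcases neg_one_pow_eq_or (ExteriorAlgebra R V) k with h | h <;> simp [h]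

theorem ι_mul_comm {l : ℕ} (v : V) {b : ExteriorAlgebra R V} (hb : b ∈ ⋀[R]^l V) :
    ι R v * b = (-1) ^ l * (b * ι R v) := by
  induction l generalizing b with
  | zero =>
    obtain ⟨r, rfl⟩ := mem_exteriorPower_zero.1 hb
    simpa using (Algebra.commutes r (ι R v)).symm
  | succ l ih =>
    refine exteriorPower_succ_induction hb (fun b hb w => ?_) (fun b b' h h' => ?_)
    · have h : ι R v * ι R w = - (ι R w * ι R v) :=
        eq_neg_of_add_eq_zero_left (ι_add_mul_swap v w)
      rw [← mul_assoc, ih hb, mul_assoc, mul_assoc, h, pow_succ, mul_assoc]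
      simp [mul_assoc]
    · rw [mul_add, h, h', add_mul, mul_add]

theorem mul_comm_of_mem {k l : ℕ} {a b : ExteriorAlgebra R V} (ha : a ∈ ⋀[R]^k V)
    (hb : b ∈ ⋀[R]^l V) : a * b = (-1) ^ (k * l) * (b * a) := by
  induction k generalizing a with
  | zero =>
    obtain ⟨r, rfl⟩ := mem_exteriorPower_zero.1 ha
    simpa using Algebra.commutes r b
  | succ k ih =>
    refine exteriorPower_succ_induction ha (fun a ha w => ?_) (fun a a' h h' => ?_)
    · rw [mul_assoc, ι_mul_comm w hb, neg_one_pow_mul_comm, ← mul_assoc a, ih ha, add_mul, one_mul,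
        add_comm, pow_add]
      simp only [mul_assoc]
    · rw [add_mul, h, h', mul_add, mul_add]

/-- The algebra homomorphism `a ↦ a + ε δ(a)`, where `δ` is the derivation which extends `L`. -/
noncomputable def derivationHom (L : V →ₗ[R] V) :
    ExteriorAlgebra R V →ₐ[R] TrivSqZeroExt (ExteriorAlgebra R V) (ExteriorAlgebra R V) :=
  lift R ⟨{ toFun := fun v => TrivSqZeroExt.inl (ι R v) + TrivSqZeroExt.inr (ι R (L v))
            map_add' := fun v w => by ext <;> simp
            map_smul' := fun r v => by ext <;> simp },
    -- The image of `v` squares to zero: its `ε`-part is `v ∧ L v + L v ∧ v = 0`.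
    fun v => by ext <;> simp [ι_add_mul_swap]⟩

/-- With the identity as first component, multiplicativity of the homomorphism is the Leibniz rule
for the second. -/
theorem fst_derivationHom (L : V →ₗ[R] V) (a : ExteriorAlgebra R V) :
    (derivationHom L a).fst = a := by
  have : (TrivSqZeroExt.fstHom R _ _).comp (derivationHom L) = AlgHom.id R _ := by
    ext v
    simp [derivationHom]
  exact DFunLike.congr_fun this a

/-- The derivation of the exterior algebra of `V` which extends an endomorphism of `V`. -/
noncomputable def derivation (L : V →ₗ[R] V) : ExteriorAlgebra R V →ₗ[R] ExteriorAlgebra R V :=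
  (TrivSqZeroExt.sndHom _ _).restrictScalars R ∘ₗ (derivationHom L).toLinearMap

theorem derivation_ι (L : V →ₗ[R] V) (v : V) : derivation L (ι R v) = ι R (L v) := by
  simp [derivation, derivationHom]

theorem derivation_algebraMap (L : V →ₗ[R] V) (r : R) :
    derivation L (algebraMap R _ r) = 0 := by
  simp [derivation, TrivSqZeroExt.algebraMap_eq_inl']

theorem derivation_mul (L : V →ₗ[R] V) (a b : ExteriorAlgebra R V) :
    derivation L (a * b) = derivation L a * b + a * derivation L b := by
  simp [derivation, fst_derivationHom, add_comm]

theorem derivation_mem {k : ℕ} (L : V →ₗ[R] V) {a : ExteriorAlgebra R V} (ha : a ∈ ⋀[R]^k V) :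
    derivation L a ∈ ⋀[R]^k V := by
  induction k generalizing a with
  | zero =>
    obtain ⟨r, rfl⟩ := mem_exteriorPower_zero.1 ha
    rw [derivation_algebraMap]
    exact Submodule.zero_mem _
  | succ k ih =>
    refine exteriorPower_succ_induction ha (fun a ha w => ?_) (fun a a' h h' => ?_)
    · rw [derivation_mul, derivation_ι]
      exact Submodule.add_mem _ (mul_mem_exteriorPower (ih ha) (ι_mem_exteriorPower_one _))
        (mul_mem_exteriorPower ha (ι_mem_exteriorPower_one _))
    · rw [map_add]; exact Submodule.add_mem _ h h'

theorem exteriorPower_eq_bot_of_finrank_lt {K W : Type*} [Field K] [AddCommGroup W] [Module K W]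
    [FiniteDimensional K W] {k : ℕ} (h : Module.finrank K W < k) : ⋀[K]^k W = ⊥ := by
  have := exteriorPower.finrank_eq K k (M := W)
  rw [Nat.choose_eq_zero_of_lt h] at this
  exact Submodule.finrank_eq_zero.1 this

end ExteriorAlgebra

namespace HigherConn

/-! ### Multivector fields: evaluation, bump functions, smoothness in a trivialization -/

open scoped Topology

variable {n : ℕ} {M : Type*} [TopologicalSpace M] [ChartedSpace (Model n) M]
  [IsManifold (𝓡 n) ∞ M]

/-- The trivialization of `TM` around `x`. -/
noncomputable abbrev triv (x : M) :
    Bundle.Trivialization (Model n) (Bundle.TotalSpace.proj : Bundle.TotalSpace (Model n)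
      (TangentSpace (𝓡 n) : M → Type _) → M) :=
  trivializationAt (Model n) (TangentSpace (𝓡 n) : M → Type _) x

theorem triv_baseSet_mem_nhds {x y : M} (hy : y ∈ (triv (n := n) x).baseSet) :
    (triv (n := n) x).baseSet ∈ 𝓝 y :=
  (triv (n := n) x).open_baseSet.mem_nhds hy

theorem mem_triv_baseSet (x : M) : x ∈ (triv (n := n) x).baseSet :=
  FiberBundle.mem_baseSet_trivializationAt' x

theorem symmL_comp_continuousLinearMapAt (x : M) :
    ((triv x).symmL ℝ x).toLinearMap ∘ₗ ((triv x).continuousLinearMapAt ℝ x).toLinearMap =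
      (LinearMap.id : TangentSpace (𝓡 n) x →ₗ[ℝ] _) := by
  ext1 v
  exact (triv (n := n) x).symmL_continuousLinearMapAt (mem_triv_baseSet x) v

@[simp]
theorem smul_apply (f : SmoothFun n M) (X : MVF n M) (x : M) : (f • X).1 x = f x • X.1 x := by
  rw [Algebra.smul_def, Algebra.smul_def]; rfl

@[simp]
theorem ofFun_apply (f : SmoothFun n M) (x : M) : (ofFun n M f).1 x = algebraMap ℝ _ (f x) := rfl

@[simp]
theorem ofVField_apply (V : VField n M) (x : M) :
    (ofVField V).1 x = ExteriorAlgebra.ι ℝ (V x) := rfl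

@[simp]
theorem sum_apply {ι : Type*} (s : Finset ι) (X : ι → MVF n M) (x : M) :
    (∑ i ∈ s, X i).1 x = ∑ i ∈ s, (X i).1 x := by
  rw [AddSubmonoidClass.coe_finsetSum, Finset.sum_apply]

theorem MVF.ext_iff_apply {X Y : MVF n M} : X = Y ↔ ∀ x, X.1 x = Y.1 x := by
  rw [Subtype.ext_iff, funext_iff]

theorem exists_bump [T2Space M] {x : M} {s : Set M} (hs : s ∈ 𝓝 x) :
    ∃ ρ : SmoothFun n M, ρ x = 1 ∧ ∀ z ∉ s, ρ z = 0 := by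
  obtain ⟨f, hf, -⟩ := (SmoothBumpFunction.nhds_basis_support (I := 𝓡 n) hs).mem_iff.1 hs
  refine ⟨⟨f, f.contMDiff⟩, f.eq_one, fun z hz => ?_⟩
  by_contra h
  exact hz (hf (subset_tsupport _ h))

/-- The axioms speak of global fields only. This turns equality of germs into a global equality, to
which they can be applied. -/
theorem exists_bump_smul_eq [T2Space M] {x : M} {X Y : MVF n M}
    (h : ∀ᶠ y in 𝓝 x, X.1 y = Y.1 y) :
    ∃ ρ : SmoothFun n M, ρ x = 1 ∧ ρ • X = ρ • Y := by
  obtain ⟨ρ, h1, h0⟩ := exists_bump (n := n) h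
  refine ⟨ρ, h1, MVF.ext_iff_apply.2 fun y => ?_⟩
  by_cases hy : X.1 y = Y.1 y
  · rw [smul_apply, smul_apply, hy]
  · rw [smul_apply, smul_apply, h0 y hy, zero_smul, zero_smul]

/-- In the trivialization around `x`, the section `X` of `⋀^• TM` is smooth at `y`. -/
def CoordSmoothAt (X : RawField n M) (x y : M) : Prop :=
  ∀ φ : Module.Dual ℝ (ExteriorAlgebra ℝ (Model n)),
    ContMDiffAt (𝓡 n) 𝓘(ℝ, ℝ) ∞ (fun z => φ (coord X x z)) y

namespace CoordSmoothAt

variable {X Y : RawField n M} {x y : M}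

theorem add (hX : CoordSmoothAt X x y) (hY : CoordSmoothAt Y x y) :
    CoordSmoothAt (X + Y) x y := by
  intro φ
  have h : (fun z => φ (coord (X + Y) x z)) =
      fun z => φ (coord X x z) + φ (coord Y x z) := by
    funext z; simp [coord]
  rw [h]
  exact (hX φ).add (hY φ)

theorem mul (hX : CoordSmoothAt X x y) (hY : CoordSmoothAt Y x y) :
    CoordSmoothAt (X * Y) x y := by
  intro φ
  let b := ((EuclideanSpace.basisFun (Fin n) ℝ).toBasis).ExteriorAlgebra
  have key : (fun z => φ (coord (X * Y) x z)) = fun z => ∑ s, ∑ t,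
      (b.coord s (coord X x z) * b.coord t (coord Y x z)) * φ (b s * b t) := by
    funext z
    have h : coord (X * Y) x z = coord X x z * coord Y x z := by simp [coord]
    rw [h]
    conv_lhs => rw [← b.sum_repr (coord X x z), ← b.sum_repr (coord Y x z)]
    simp only [Finset.sum_mul_sum, map_sum, smul_mul_smul_comm, map_smul, smul_eq_mul,
      Module.Basis.coord_apply]
  rw [key]
  refine ContMDiffAt.sum fun s _ => ContMDiffAt.sum fun t _ => ?_
  exact ((hX _).mul (hY _)).mul contMDiffAt_const

theorem rawOfFun {f : M → ℝ} (hf : ContMDiffAt (𝓡 n) 𝓘(ℝ, ℝ) ∞ f y) :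
    CoordSmoothAt (rawOfFun (n := n) f) x y := by
  intro φ
  have h : (fun z => φ (coord (HigherConn.rawOfFun f) x z)) = fun z => f z * φ 1 := by
    funext z
    simp [coord, HigherConn.rawOfFun, Algebra.algebraMap_eq_smul_one]
  rw [h]
  exact hf.mul contMDiffAt_const

theorem ofVField (V : VField n M) (hy : y ∈ (triv (n := n) x).baseSet) :
    CoordSmoothAt (ofVField V).1 x y := by
  intro φ
  have hV := ((triv (n := n) x).contMDiffAt_section_iff hy).1 (V.contMDiff y)
  let ψ : Model n →L[ℝ] ℝ := LinearMap.toContinuousLinearMap (φ ∘ₗ ExteriorAlgebra.ι ℝ)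
  refine (ψ.contMDiff.contMDiffAt.comp y hV).congr_of_eventuallyEq ?_
  filter_upwards [triv_baseSet_mem_nhds hy] with z hz
  simp only [coord, ψ, ExteriorAlgebra.map_apply_ι, LinearMap.coe_toContinuousLinearMap',
    LinearMap.comp_apply, ContinuousLinearMap.coe_coe, ofVField_apply, Function.comp]
  exact congrArg (fun v => φ (ExteriorAlgebra.ι ℝ v))
    (Bundle.Trivialization.continuousLinearMapAt_apply_of_mem (R := ℝ) _ hz (V z))

end CoordSmoothAt

theorem ofVField_mem (V : VField n M) : ofVField V ∈ A n M 1 := fun _ =>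
  ExteriorAlgebra.ι_mem_exteriorPower_one _

theorem mul_mem_A {k l : ℕ} {X Y : MVF n M} (hX : X ∈ A n M k) (hY : Y ∈ A n M l) :
    X * Y ∈ A n M (k + l) := fun x =>
  ExteriorAlgebra.mul_mem_exteriorPower (hX x) (hY x)

theorem ofFun_mem (f : SmoothFun n M) : ofFun n M f ∈ A n M 0 := fun x =>
  ExteriorAlgebra.mem_exteriorPower_zero.2 ⟨f x, rfl⟩

/-- A basis of `⋀^• TₓM`. -/
noncomputable def extBasis (x : M) :
    Module.Basis (Finset (Fin n)) ℝ (ExteriorAlgebra ℝ (TangentSpace (𝓡 n) x)) :=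
  Module.Basis.ExteriorAlgebra (M := TangentSpace (𝓡 n) x)
    (EuclideanSpace.basisFun (Fin n) ℝ).toBasis

/-- The functionals which express, in the trivialization of `TM` around `x`, the coefficients of a
multivector field with respect to the extensions of a basis of `⋀^• TₓM`. -/
noncomputable def coeffDual (x : M) (s : Finset (Fin n)) :
    Module.Dual ℝ (ExteriorAlgebra ℝ (Model n)) :=
  (extBasis x).coord s ∘ₗ (ExteriorAlgebra.map ((triv x).symmL ℝ x).toLinearMap).toLinearMap

theorem coeffDual_coord_self (X : RawField n M) (x : M) (s : Finset (Fin n)) :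
    coeffDual x s (coord X x x) = (extBasis x).coord s (X x) := by
  simp only [coeffDual, coord, LinearMap.comp_apply, AlgHom.toLinearMap_apply]
  congr 1
  rw [← AlgHom.comp_apply, ExteriorAlgebra.map_comp_map]
  rw [symmL_comp_continuousLinearMapAt]
  simp

/-- The wedge product of a list of vector fields. -/
noncomputable def wedge (L : List (VField n M)) : MVF n M := (L.map ofVField).prod

@[simp]
theorem wedge_nil : wedge ([] : List (VField n M)) = 1 := rfl

@[simp]
theorem wedge_cons (V : VField n M) (L : List (VField n M)) :
    wedge (V :: L) = ofVField V * wedge L := by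
  simp [wedge]

theorem wedge_mem (L : List (VField n M)) : wedge L ∈ A n M L.length := by
  induction L with
  | nil => rw [wedge_nil, ← map_one (ofFun n M)]; exact ofFun_mem 1
  | cons V L ih =>
    rw [wedge_cons, List.length_cons, add_comm]
    exact mul_mem_A (ofVField_mem V) ih

/-! ### Extension of multivectors at a point, and local frames -/

section Extension

variable [T2Space M]

/-- A bump function at `x`. -/
noncomputable def bump (x : M) : SmoothBumpFunction (𝓡 n) x :=
  Classical.arbitrary _

/-- A vector field which, near `x`, is constant in the trivialization of `TM` around `x`, with a
given value at `x`. -/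
noncomputable def extVector (x : M) : TangentSpace (𝓡 n) x →ₗ[ℝ] VField n M where
  toFun v := ⟨fun y => (bump (n := n) x) y •
      (triv x).symmL ℝ y ((triv x).continuousLinearMapAt ℝ x v), by
    refine ContMDiffOn.smul_section_of_tsupport (u := (triv (n := n) x).baseSet)
      (SmoothBumpFunction.contMDiff _).contMDiffOn (triv x).open_baseSet ?_ ?_
    · exact SmoothBumpFunction.tsupport_subset_chartAt_source _
    · rw [(triv (n := n) x).contMDiffOn_section_baseSet_iff]
      refine (contMDiffOn_const (c := (triv x).continuousLinearMapAt ℝ x v)).congr fun y hy => ?_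
      rw [← (triv (n := n) x).continuousLinearMapAt_apply_of_mem (R := ℝ) hy]
      exact (triv (n := n) x).continuousLinearMapAt_symmL hy _⟩
  map_add' v w := by ext y; simp
  map_smul' c v := by
    ext1 y
    change bump (n := n) x y • (triv x).symmL ℝ y ((triv x).continuousLinearMapAt ℝ x (c • v)) =
      c • bump (n := n) x y • (triv x).symmL ℝ y ((triv x).continuousLinearMapAt ℝ x v)
    rw [map_smul, map_smul, smul_comm]

theorem extVector_eventually (x : M) : ∀ᶠ y in 𝓝 x, y ∈ (triv (n := n) x).baseSet ∧
    ∀ v : TangentSpace (𝓡 n) x,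
      extVector x v y = (triv x).symmL ℝ y ((triv x).continuousLinearMapAt ℝ x v) := by
  filter_upwards [triv_baseSet_mem_nhds (mem_triv_baseSet (n := n) x),
    (bump (n := n) x).eventuallyEq_one] with y hy h
  refine ⟨hy, fun v => ?_⟩
  exact (congrArg (· • _) h).trans (one_smul _ _)

theorem extVector_self (x : M) (v : TangentSpace (𝓡 n) x) : extVector x v x = v := by
  rw [(extVector_eventually x).self_of_nhds.2]
  exact (triv (n := n) x).symmL_continuousLinearMapAt (mem_triv_baseSet x) v

/-- The algebra homomorphism underlying `extend`. -/
noncomputable def rawExtend (x : M) :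
    ExteriorAlgebra ℝ (TangentSpace (𝓡 n) x) →ₐ[ℝ] RawField n M :=
  ExteriorAlgebra.lift ℝ ⟨
    { toFun := fun v => (ofVField (extVector x v)).1
      map_add' := fun v w => by funext y; simp
      map_smul' := fun c v => by funext y; simp },
    fun v => by funext y; simp⟩

@[simp]
theorem rawExtend_ι (x : M) (v : TangentSpace (𝓡 n) x) :
    rawExtend x (ExteriorAlgebra.ι ℝ v) = (ofVField (extVector x v)).1 := by
  simp [rawExtend]

theorem rawExtend_algebraMap (x : M) (c : ℝ) :
    rawExtend (n := n) x (algebraMap ℝ _ c) = rawOfFun fun _ => c := by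
  simp only [AlgHom.commutes]; rfl

theorem coordSmoothAt_rawExtend {x y z : M} (hz : z ∈ (triv (n := n) y).baseSet)
    (ξ : ExteriorAlgebra ℝ (TangentSpace (𝓡 n) x)) : CoordSmoothAt (rawExtend x ξ) y z := by
  induction ξ using ExteriorAlgebra.induction with
  | algebraMap r =>
    rw [rawExtend_algebraMap]
    exact .rawOfFun contMDiffAt_const
  | ι v =>
    rw [rawExtend_ι]
    exact .ofVField _ hz
  | mul a b ha hb => rw [map_mul]; exact ha.mul hb
  | add a b ha hb => rw [map_add]; exact ha.add hb

/-- Extension of a multivector at `x` to a multivector field. -/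
noncomputable def extend (x : M) : ExteriorAlgebra ℝ (TangentSpace (𝓡 n) x) →+* MVF n M :=
  (rawExtend x).toRingHom.codRestrict (MVF n M) fun ξ y =>
    coordSmoothAt_rawExtend (mem_triv_baseSet y) ξ

@[simp]
theorem extend_ι (x : M) (v : TangentSpace (𝓡 n) x) :
    extend x (ExteriorAlgebra.ι ℝ v) = ofVField (extVector x v) :=
  Subtype.ext (rawExtend_ι x v)

/-- Constant functions. -/
noncomputable abbrev constFun (n : ℕ) (M : Type*) [TopologicalSpace M] [ChartedSpace (Model n) M] (c : ℝ) :
    SmoothFun n M :=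
  ContMDiffMap.const c

theorem extend_algebraMap (x : M) (c : ℝ) :
    extend (n := n) x (algebraMap ℝ _ c) = ofFun n M (constFun n M c) :=
  Subtype.ext (rawExtend_algebraMap x c)

theorem extend_smul (x : M) (c : ℝ) (ξ : ExteriorAlgebra ℝ (TangentSpace (𝓡 n) x)) :
    extend x (c • ξ) = constFun n M c • extend x ξ := by
  rw [Algebra.smul_def, map_mul, extend_algebraMap, Algebra.smul_def]
  rfl

/-- One neighbourhood serves all `ξ`: evaluation at `y` makes both sides algebra homomorphisms in
`ξ`, so it suffices to compare them on vectors, where the bump function is `1`. -/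
theorem extend_eventually (x : M) : ∀ᶠ y in 𝓝 x, ∀ ξ : ExteriorAlgebra ℝ (TangentSpace (𝓡 n) x),
    (extend x ξ).1 y = ExteriorAlgebra.map (((triv x).symmL ℝ y).toLinearMap ∘ₗ
      ((triv x).continuousLinearMapAt ℝ x).toLinearMap) ξ := by
  filter_upwards [extVector_eventually (n := n) x] with y hy ξ
  have h : (Pi.evalAlgHom ℝ _ y).comp (rawExtend (n := n) x) =
      ExteriorAlgebra.map (((triv x).symmL ℝ y).toLinearMap ∘ₗ
        ((triv x).continuousLinearMapAt ℝ x).toLinearMap) := by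
    ext v
    simp [hy.2]
  exact DFunLike.congr_fun h ξ

theorem extend_self (x : M) (ξ : ExteriorAlgebra ℝ (TangentSpace (𝓡 n) x)) :
    (extend x ξ).1 x = ξ := by
  rw [(extend_eventually x).self_of_nhds, symmL_comp_continuousLinearMapAt]
  simp

theorem extend_mem {x : M} {k : ℕ} {ξ : ExteriorAlgebra ℝ (TangentSpace (𝓡 n) x)}
    (hξ : ξ ∈ ⋀[ℝ]^k (TangentSpace (𝓡 n) x)) : extend x ξ ∈ A n M k := by
  induction k generalizing ξ with
  | zero =>
    obtain ⟨r, rfl⟩ := ExteriorAlgebra.mem_exteriorPower_zero.1 hξ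
    rw [extend_algebraMap]
    exact ofFun_mem _
  | succ k ih =>
    refine ExteriorAlgebra.exteriorPower_succ_induction hξ (fun a ha v => ?_) fun a b h h' => ?_
    · rw [map_mul, extend_ι]
      exact mul_mem_A (ih ha) (ofVField_mem _)
    · rw [map_add]; exact Submodule.add_mem _ h h'

/-- Near `x`, `extend` is transport from `x` to `y` through the trivialization. The coefficients are
those of `X y` carried back to `x`. -/
theorem eventually_eq_sum_extend (X : RawField n M) (x : M) : ∀ᶠ y in 𝓝 x,
    X y = ∑ s, coeffDual x s (coord X x y) • (extend x (extBasis x s)).1 y := by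
  filter_upwards [extend_eventually (n := n) x,
    triv_baseSet_mem_nhds (mem_triv_baseSet (n := n) x)] with y h hy
  simp only [h, coeffDual, LinearMap.comp_apply, AlgHom.toLinearMap_apply,
    Module.Basis.coord_apply, ← map_smul, ← map_sum]
  rw [(extBasis x).sum_repr]
  simp only [coord]
  rw [← AlgHom.comp_apply, ← AlgHom.comp_apply, ExteriorAlgebra.map_comp_map,
    ExteriorAlgebra.map_comp_map]
  have : ((((triv x).symmL ℝ y).toLinearMap ∘ₗ
      ((triv x).continuousLinearMapAt ℝ x).toLinearMap) ∘ₗ ((triv x).symmL ℝ x).toLinearMap) ∘ₗ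
        ((triv x).continuousLinearMapAt ℝ y).toLinearMap =
          (LinearMap.id : TangentSpace (𝓡 n) y →ₗ[ℝ] _) := by
    ext1 v
    have h1 := (triv (n := n) x).continuousLinearMapAt_symmL (R := ℝ) (mem_triv_baseSet x)
      ((triv x).continuousLinearMapAt ℝ y v)
    have h2 := (triv (n := n) x).symmL_continuousLinearMapAt (R := ℝ) hy v
    simp only [LinearMap.comp_apply, ContinuousLinearMap.coe_coe, LinearMap.id_apply]
    rw [h1, h2]
  rw [this]
  simp

/-- `IsSmooth` tests each trivialization only at its centre. To change trivialization, expand `X` in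
the frame extended from `y`: its coefficients are smooth at `y` by hypothesis, and the frame is
smooth in the trivialization around `x`. -/
theorem IsSmooth.coordSmoothAt {X : RawField n M} (hX : IsSmooth X) {x y : M}
    (hy : y ∈ (triv (n := n) x).baseSet) : CoordSmoothAt X x y := by
  intro φ
  have h : ContMDiffAt (𝓡 n) 𝓘(ℝ, ℝ) ∞ (fun z => ∑ s, coeffDual y s (coord X y z) *
      φ (coord (extend y (extBasis y s)).1 x z)) y :=
    ContMDiffAt.sum fun s _ => (hX y _).mul (coordSmoothAt_rawExtend hy _ φ)
  refine h.congr_of_eventuallyEq ?_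
  filter_upwards [eventually_eq_sum_extend X y] with z hz
  conv_lhs => rw [coord, hz]
  simp [coord]

theorem exists_eventually_eq_sum (X : MVF n M) (x : M) : ∃ f : Finset (Fin n) → SmoothFun n M,
    (∀ s, f s x = (extBasis x).coord s (X.1 x)) ∧
      ∀ᶠ y in 𝓝 x, X.1 y = (∑ s, f s • extend x (extBasis x s)).1 y := by
  let ρ := bump (n := n) x
  -- The coefficients are smooth only over the domain of the trivialization; the bump function makes
  -- them global without changing them near `x`.
  refine ⟨fun s => ⟨fun y => ρ y • coeffDual x s (coord X.1 x y), ρ.contMDiff_smul ?_⟩, ?_, ?_⟩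
  · exact fun y hy => (IsSmooth.coordSmoothAt X.2 hy _).contMDiffWithinAt
  · intro s
    change ρ x • coeffDual x s (coord X.1 x x) = _
    rw [ρ.eq_one, one_smul, coeffDual_coord_self]
  · filter_upwards [eventually_eq_sum_extend X.1 x, ρ.eventuallyEq_one] with y hy hρ
    rw [hy, sum_apply]
    refine Finset.sum_congr rfl fun s _ => ?_
    refine Eq.trans ?_ (smul_apply _ _ _).symm
    change _ = (ρ y • coeffDual x s (coord X.1 x y)) • _
    rw [hρ, Pi.one_apply, one_smul]

theorem extend_ιMulti (x : M) {k : ℕ} (v : Fin k → TangentSpace (𝓡 n) x) :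
    extend x (ExteriorAlgebra.ιMulti ℝ k v) = wedge (List.ofFn fun i => extVector x (v i)) := by
  rw [ExteriorAlgebra.ιMulti_apply, map_list_prod, wedge, List.map_ofFn, List.map_ofFn]
  congr 2
  funext i
  simp

theorem extend_mem_span (x : M) (ξ : ExteriorAlgebra ℝ (TangentSpace (𝓡 n) x)) :
    extend x ξ ∈ Submodule.span (SmoothFun n M) (Set.range (wedge (n := n) (M := M))) := by
  have hξ : ξ ∈ Submodule.span ℝ (Set.range fun v : Σ k, (Fin k → TangentSpace (𝓡 n) x) =>
      ExteriorAlgebra.ιMulti ℝ v.1 v.2) := by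
    rw [ExteriorAlgebra.ιMulti_span]; trivial
  induction hξ using Submodule.span_induction with
  | mem a ha =>
    obtain ⟨v, rfl⟩ := ha
    exact Submodule.subset_span ⟨_, (extend_ιMulti x v.2).symm⟩
  | zero => rw [map_zero]; exact Submodule.zero_mem _
  | add a b _ _ ha hb => rw [map_add]; exact Submodule.add_mem _ ha hb
  | smul c a _ ha => rw [extend_smul]; exact Submodule.smul_mem _ _ ha

/-- Near any point, a multivector field is a `C^∞(M)`-linear combination of wedge products of
vector fields. -/
theorem exists_mem_span_eventually_eq (X : MVF n M) (x : M) :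
    ∃ Y ∈ Submodule.span (SmoothFun n M) (Set.range (wedge (n := n) (M := M))),
      ∀ᶠ y in 𝓝 x, X.1 y = Y.1 y := by
  obtain ⟨f, -, hf⟩ := exists_eventually_eq_sum X x
  exact ⟨_, Submodule.sum_mem _ fun s _ => Submodule.smul_mem _ _ (extend_mem_span x _), hf⟩

/-- An additive map on multivector fields is tensorial at `x` if it is linear over evaluation of
functions at `x`. -/
def Tensorial {W : Type*} [AddCommGroup W] [Module ℝ W] (T : MVF n M →+ W) (x : M) : Prop :=
  ∀ (f : SmoothFun n M) (X : MVF n M), T (f • X) = f x • T X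

/-! ### Tensorial maps depend only on the value at the point -/

namespace Tensorial

variable {W : Type*} [AddCommGroup W] [Module ℝ W] {T : MVF n M →+ W} {x : M}

theorem eq_of_eventually_eq (hT : Tensorial T x) {X Y : MVF n M}
    (h : ∀ᶠ y in 𝓝 x, X.1 y = Y.1 y) : T X = T Y := by
  obtain ⟨ρ, h1, hXY⟩ := exists_bump_smul_eq h
  have hX := hT ρ X
  have hY := hT ρ Y
  rw [h1, one_smul] at hX hY
  rw [← hX, ← hY, hXY]

/-- In a local frame the coefficients come out evaluated at `x`, so only `X(x)` counts. -/
theorem apply_extend (hT : Tensorial T x) (X : MVF n M) : T (extend x (X.1 x)) = T X := by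
  obtain ⟨f, hf, h⟩ := exists_eventually_eq_sum X x
  rw [hT.eq_of_eventually_eq h]
  conv_lhs => rw [← (extBasis x).sum_repr (X.1 x)]
  rw [map_sum, map_sum, map_sum]
  refine Finset.sum_congr rfl fun s _ => ?_
  rw [extend_smul, hT, hT, hf]
  rfl

theorem eq_zero (hT : Tensorial T x) (h : ∀ L, T (wedge L) = 0) (X : MVF n M) : T X = 0 := by
  rw [← hT.apply_extend]
  have hX := extend_mem_span x (X.1 x)
  generalize extend x (X.1 x) = Y at hX
  induction hX using Submodule.span_induction with
  | mem a ha => obtain ⟨L, rfl⟩ := ha; exact h L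
  | zero => exact map_zero T
  | add a b _ _ ha hb => rw [map_add, ha, hb, add_zero]
  | smul f a _ ha => rw [hT, ha, smul_zero]

end Tensorial

end Extension

open CliffordAlgebra (contractRight)

@[simp]
theorem add_apply (X Y : MVF n M) (x : M) : (X + Y).1 x = X.1 x + Y.1 x := rfl

@[simp]
theorem sub_apply (X Y : MVF n M) (x : M) : (X - Y).1 x = X.1 x - Y.1 x := rfl

@[simp]
theorem mul_apply (X Y : MVF n M) (x : M) : (X * Y).1 x = X.1 x * Y.1 x := rfl

theorem isSmooth_of_eventually_eq {X : RawField n M}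
    (h : ∀ x, ∃ Y : RawField n M, IsSmooth Y ∧ ∀ᶠ y in 𝓝 x, X y = Y y) : IsSmooth X := by
  intro x φ
  obtain ⟨Y, hY, hXY⟩ := h x
  refine (hY x φ).congr_of_eventuallyEq ?_
  filter_upwards [hXY] with y hy
  rw [coord, coord, hy]

omit [IsManifold (𝓡 n) ∞ M] in
theorem mvfderiv_constFun (c : ℝ) (x : M) : mvfderiv (𝓡 n) (constFun n M c) x = 0 :=
  mvfderiv_const c

theorem exists_ι_eq {X : MVF n M} (hX : X ∈ A n M 1) (x : M) :
    ∃ v : TangentSpace (𝓡 n) x, ExteriorAlgebra.ι ℝ v = X.1 x := by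
  have := hX x
  rw [ExteriorAlgebra.exteriorPower, pow_one] at this
  exact this

/-! ### The derivation along a vector field and the induced higher connection -/

namespace HigherConnection

variable (N : HigherConnection n M)

theorem zero_left (Y : MVF n M) : N.toFun 0 Y = 0 := by
  simpa using N.fun_left 0 Y

/-- `∇_X Y` at `x`, as an additive function of `X`. -/
noncomputable def leftHom (Y : MVF n M) (x : M) :
    MVF n M →+ ExteriorAlgebra ℝ (TangentSpace (𝓡 n) x) where
  toFun X := (N.toFun X Y).1 x
  map_zero' := by rw [zero_left]; rfl
  map_add' X X' := by
    have h := N.linear_left 1 X X' Y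
    rw [one_smul, one_smul] at h
    rw [h]; rfl

@[simp]
theorem leftHom_apply (Y : MVF n M) (x : M) (X : MVF n M) :
    N.leftHom Y x X = (N.toFun X Y).1 x := rfl

theorem tensorial_leftHom (Y : MVF n M) (x : M) : Tensorial (N.leftHom Y x) x := by
  intro f X
  have h := N.linear_left f X 0 Y
  rw [add_zero, zero_left, add_zero] at h
  rw [leftHom_apply, h, smul_apply]
  rfl

/-- `∇_X Y` at `x`, as an additive function of `Y`. -/
noncomputable def rightHom (X : MVF n M) (x : M) :
    MVF n M →+ ExteriorAlgebra ℝ (TangentSpace (𝓡 n) x) :=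
  AddMonoidHom.mk' (fun Y => (N.toFun X Y).1 x) fun Y Y' => by rw [N.add_right]; rfl

@[simp]
theorem rightHom_apply (X : MVF n M) (x : M) (Y : MVF n M) :
    N.rightHom X x Y = (N.toFun X Y).1 x := rfl

theorem rightHom_smul (V : VField n M) (x : M) (f : SmoothFun n M) (Y : MVF n M) :
    N.rightHom (ofVField V) x (f • Y) =
      mvfderiv (𝓡 n) f x (V x) • Y.1 x + f x • N.rightHom (ofVField V) x Y := by
  have h := congrFun (N.leibniz 1 (ofVField V) (ofVField_mem V) f Y) x
  rw [bracket_ofVField] at h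
  rw [rightHom_apply, h]
  change algebraMap ℝ _ _ * Y.1 x + (f • N.toFun (ofVField V) Y).1 x = _
  rw [smul_apply, ← Algebra.smul_def]
  rfl

theorem rightHom_ofFun (V : VField n M) (x : M) (f : SmoothFun n M) :
    N.rightHom (ofVField V) x (ofFun n M f) = algebraMap ℝ _ (mvfderiv (𝓡 n) f x (V x)) := by
  have h := congrFun (N.apply_fun 1 (ofVField V) (ofVField_mem V) f) x
  rw [bracket_ofVField] at h
  exact h

theorem rightHom_sum (V : VField n M) (x : M) {ι : Type*} (s : Finset ι) (f : ι → SmoothFun n M)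
    (hf : ∀ i ∈ s, f i x = 0) (E : ι → MVF n M) :
    N.rightHom (ofVField V) x (∑ i ∈ s, f i • E i) =
      ∑ i ∈ s, mvfderiv (𝓡 n) (f i) x (V x) • (E i).1 x := by
  rw [map_sum]
  refine Finset.sum_congr rfl fun i hi => ?_
  rw [rightHom_smul, hf i hi, zero_smul, add_zero]

section Extension

variable [T2Space M]

/-- `∇_V` is not tensorial, but the extra terms `V(ρ) Y(x)` and `V(ρ) Z(x)` coincide because `Y(x) =
Z(x)`. -/
theorem rightHom_eq_of_eventually_eq (V : VField n M) {x : M} {Y Z : MVF n M}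
    (h : ∀ᶠ y in 𝓝 x, Y.1 y = Z.1 y) :
    N.rightHom (ofVField V) x Y = N.rightHom (ofVField V) x Z := by
  obtain ⟨ρ, h1, hYZ⟩ := exists_bump_smul_eq h
  have hY := N.rightHom_smul V x ρ Y
  rw [hYZ, N.rightHom_smul V x ρ Z, h.self_of_nhds, h1, one_smul, one_smul] at hY
  exact (add_left_cancel hY).symm

/-- `N` need not respect products, yet here it must: `P = ∑ fₛ Eₛ` near `x` with `fₛ(x) = 0`, so the
Leibniz rule over functions leaves only `∑ V(fₛ) Eₛ(x) ∧ Z(x)`. -/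
theorem rightHom_mul_of_left_eq_zero (V : VField n M) {x : M} {P : MVF n M} (hP : P.1 x = 0)
    (Z : MVF n M) :
    N.rightHom (ofVField V) x (P * Z) = N.rightHom (ofVField V) x P * Z.1 x := by
  obtain ⟨f, hf, h⟩ := exists_eventually_eq_sum P x
  have hf0 : ∀ s ∈ Finset.univ, f s x = 0 := fun s _ => by rw [hf, hP, map_zero]
  have h' : ∀ᶠ y in 𝓝 x, (P * Z).1 y =
      (∑ s, f s • (extend x (extBasis x s) * Z)).1 y := by
    filter_upwards [h] with y hy
    simp only [mul_apply, hy, sum_apply, smul_apply, Finset.sum_mul, smul_mul_assoc]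
  rw [N.rightHom_eq_of_eventually_eq V h, N.rightHom_eq_of_eventually_eq V h',
    N.rightHom_sum V x _ f hf0, N.rightHom_sum V x _ f hf0, Finset.sum_mul]
  simp only [mul_apply, smul_mul_assoc]

theorem rightHom_mul_of_right_eq_zero (V : VField n M) {x : M} {P : MVF n M} (hP : P.1 x = 0)
    (Z : MVF n M) :
    N.rightHom (ofVField V) x (Z * P) = Z.1 x * N.rightHom (ofVField V) x P := by
  obtain ⟨f, hf, h⟩ := exists_eventually_eq_sum P x
  have hf0 : ∀ s ∈ Finset.univ, f s x = 0 := fun s _ => by rw [hf, hP, map_zero]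
  have h' : ∀ᶠ y in 𝓝 x, (Z * P).1 y =
      (∑ s, f s • (Z * extend x (extBasis x s))).1 y := by
    filter_upwards [h] with y hy
    simp only [mul_apply, hy, sum_apply, smul_apply, Finset.mul_sum, mul_smul_comm]
  rw [N.rightHom_eq_of_eventually_eq V h, N.rightHom_eq_of_eventually_eq V h',
    N.rightHom_sum V x _ f hf0, N.rightHom_sum V x _ f hf0, Finset.mul_sum]
  simp only [mul_apply, mul_smul_comm]

/-- The endomorphism `w ↦ ∇_V W` of `TₓM`, where `W` is the extension of `w`. -/
noncomputable def christoffel (V : VField n M) (x : M) :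
    TangentSpace (𝓡 n) x →ₗ[ℝ] TangentSpace (𝓡 n) x :=
  ExteriorAlgebra.ιInv ∘ₗ
    { toFun := fun w => N.rightHom (ofVField V) x (extend x (ExteriorAlgebra.ι ℝ w))
      map_add' := fun w w' => by simp only [map_add]
      map_smul' := fun c w => by
        rw [map_smul, extend_smul, rightHom_smul, mvfderiv_constFun]
        simp [ContMDiffMap.const] }

theorem ι_christoffel (V : VField n M) (x : M) (w : TangentSpace (𝓡 n) x) :
    ExteriorAlgebra.ι ℝ (N.christoffel V x w) =
      N.rightHom (ofVField V) x (extend x (ExteriorAlgebra.ι ℝ w)) := by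
  obtain ⟨v, hv⟩ := exists_ι_eq (N.degree 1 1 1 rfl _ (ofVField_mem V) _
    (extend_mem (ExteriorAlgebra.ι_mem_exteriorPower_one w))) x
  have h : N.christoffel V x w = ExteriorAlgebra.ιInv (ExteriorAlgebra.ι ℝ v) := by
    rw [hv]; rfl
  rw [h, ExteriorAlgebra.ι_leftInverse, hv]
  rfl

/-- At `x`, the derivation along `V` of the algebra of multivector fields which extends the
covariant derivative of vector fields along `V`. -/
noncomputable def covDeriv (V : VField n M) (x : M) (Y : MVF n M) :
    ExteriorAlgebra ℝ (TangentSpace (𝓡 n) x) :=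
  N.rightHom (ofVField V) x (Y - extend x (Y.1 x)) +
    ExteriorAlgebra.derivation (N.christoffel V x) (Y.1 x)

theorem covDeriv_add (V : VField n M) (x : M) (Y Z : MVF n M) :
    N.covDeriv V x (Y + Z) = N.covDeriv V x Y + N.covDeriv V x Z := by
  simp only [covDeriv, add_apply, map_add, map_sub]
  abel

/-- Since `extend x` is multiplicative, the part of `Y ∧ Z` that vanishes at `x` splits into two
products, each with a factor vanishing at `x`. The values at `x` are handled by an algebraic
derivation. -/
theorem covDeriv_mul (V : VField n M) (x : M) (Y Z : MVF n M) :
    N.covDeriv V x (Y * Z) = N.covDeriv V x Y * Z.1 x + Y.1 x * N.covDeriv V x Z := by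
  have h : Y * Z - extend x ((Y * Z).1 x) =
      (Y - extend x (Y.1 x)) * Z + extend x (Y.1 x) * (Z - extend x (Z.1 x)) := by
    rw [mul_apply, map_mul]; noncomm_ring
  rw [covDeriv, h, map_add, rightHom_mul_of_left_eq_zero, rightHom_mul_of_right_eq_zero,
    extend_self, mul_apply, ExteriorAlgebra.derivation_mul, covDeriv, covDeriv]
  · noncomm_ring
  · rw [sub_apply, extend_self, sub_self]
  · rw [sub_apply, extend_self, sub_self]

/-- The Christoffel endomorphism is chosen to restore exactly the extension that was subtracted. -/
theorem covDeriv_ofVField (V W : VField n M) (x : M) :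
    N.covDeriv V x (ofVField W) = N.rightHom (ofVField V) x (ofVField W) := by
  rw [covDeriv, map_sub, ofVField_apply, ExteriorAlgebra.derivation_ι, ι_christoffel,
    sub_add_cancel]

theorem covDeriv_ofFun (V : VField n M) (f : SmoothFun n M) (x : M) :
    N.covDeriv V x (ofFun n M f) = algebraMap ℝ _ (mvfderiv (𝓡 n) f x (V x)) := by
  rw [covDeriv, map_sub, ofFun_apply, ExteriorAlgebra.derivation_algebraMap, extend_algebraMap,
    rightHom_ofFun, rightHom_ofFun, mvfderiv_constFun]
  simp

theorem covDeriv_smul (V : VField n M) (f : SmoothFun n M) (Y : MVF n M) (x : M) :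
    N.covDeriv V x (f • Y) =
      mvfderiv (𝓡 n) f x (V x) • Y.1 x + f x • N.covDeriv V x Y := by
  rw [show f • Y = ofFun n M f * Y from rfl, covDeriv_mul, covDeriv_ofFun, ofFun_apply,
    ← Algebra.smul_def, ← Algebra.smul_def]

theorem covDeriv_eq_of_eventually_eq (V : VField n M) {x : M} {Y Z : MVF n M}
    (h : ∀ᶠ y in 𝓝 x, Y.1 y = Z.1 y) : N.covDeriv V x Y = N.covDeriv V x Z := by
  rw [covDeriv, covDeriv, h.self_of_nhds, map_sub, map_sub, N.rightHom_eq_of_eventually_eq V h]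

theorem covDeriv_mem (V : VField n M) (x : M) {l : ℕ} {Y : MVF n M} (hY : Y ∈ A n M l) :
    N.covDeriv V x Y ∈ ⋀[ℝ]^l (TangentSpace (𝓡 n) x) :=
  Submodule.add_mem _
    (N.degree 1 l l (add_comm _ _) _ (ofVField_mem V) _
      (Submodule.sub_mem _ hY (extend_mem (hY x))) x)
    (ExteriorAlgebra.derivation_mem _ (hY x))

/-- A basis of `TₓM`. -/
noncomputable def tangentBasis (x : M) : Module.Basis (Fin n) ℝ (TangentSpace (𝓡 n) x) :=
  (EuclideanSpace.basisFun (Fin n) ℝ).toBasis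

/-- The higher connection induced by the covariant derivative of vector fields, as an operation
with values in sections of `⋀^• TM`. -/
noncomputable def rawInduced (X Y : MVF n M) : RawField n M := fun x =>
  ∑ i, contractRight (X.1 x) ((tangentBasis x).coord i) *
    N.covDeriv (extVector x (tangentBasis x i)) x Y

/-! ### Axioms, product rules and smoothness of the induced higher connection -/

theorem rawInduced_add_left (X X' Y : MVF n M) :
    N.rawInduced (X + X') Y = N.rawInduced X Y + N.rawInduced X' Y := by
  funext x
  simp only [rawInduced, add_apply, map_add, LinearMap.add_apply, add_mul,
    Finset.sum_add_distrib, Pi.add_apply]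

theorem rawInduced_smul_left (f : SmoothFun n M) (X Y : MVF n M) :
    N.rawInduced (f • X) Y = rawOfFun f * N.rawInduced X Y := by
  funext x
  simp only [rawInduced, smul_apply, map_smul, LinearMap.smul_apply, smul_mul_assoc,
    ← Finset.smul_sum]
  rw [Algebra.smul_def]
  rfl

theorem rawInduced_add_right (X Y Y' : MVF n M) :
    N.rawInduced X (Y + Y') = N.rawInduced X Y + N.rawInduced X Y' := by
  funext x
  simp only [rawInduced, covDeriv_add, mul_add, Finset.sum_add_distrib, Pi.add_apply]

theorem rawInduced_ofFun_left (f : SmoothFun n M) (Y : MVF n M) :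
    N.rawInduced (ofFun n M f) Y = 0 := by
  funext x
  refine Finset.sum_eq_zero fun i _ => ?_
  rw [ExteriorAlgebra.contractRight_eq_zero (ofFun_mem f x), zero_mul]

theorem rawInduced_ofFun_right (X : MVF n M) (f : SmoothFun n M) :
    N.rawInduced X (ofFun n M f) = bracket X f := by
  funext x
  have h := (tangentBasis x).sum_dual_apply_smul_coord (mvfderiv (𝓡 n) f x).toLinearMap
  rw [bracket, ← h, map_sum]
  refine Finset.sum_congr rfl fun i _ => ?_
  rw [covDeriv_ofFun, extVector_self, map_smul, ← Algebra.commutes, ← Algebra.smul_def]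
  rfl

theorem rawInduced_smul_right (X : MVF n M) (f : SmoothFun n M) (Y : MVF n M) :
    N.rawInduced X (f • Y) = bracket X f * Y.1 + rawOfFun f * N.rawInduced X Y := by
  rw [← N.rawInduced_ofFun_right]
  funext x
  simp only [rawInduced, covDeriv_smul, covDeriv_ofFun, Pi.add_apply, Pi.mul_apply,
    Finset.sum_mul, mul_add, Finset.sum_add_distrib]
  congr 1
  · refine Finset.sum_congr rfl fun i _ => ?_
    rw [mul_assoc, Algebra.smul_def]
  · rw [rawOfFun, ← Algebra.smul_def, Finset.smul_sum]
    refine Finset.sum_congr rfl fun i _ => ?_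
    rw [mul_smul_comm]

theorem rawInduced_mul_left {k l : ℕ} {X Y : MVF n M} (hX : X ∈ A n M k) (hY : Y ∈ A n M l)
    (Z : MVF n M) :
    N.rawInduced (X * Y) Z =
      X.1 * N.rawInduced Y Z + (-1) ^ (k * l) * (Y.1 * N.rawInduced X Z) := by
  funext x
  simp only [rawInduced, Pi.add_apply, Pi.mul_apply, Pi.pow_apply, Pi.neg_apply, Pi.one_apply,
    Finset.mul_sum, ← Finset.sum_add_distrib]
  refine Finset.sum_congr rfl fun i _ => ?_
  rw [mul_apply, ExteriorAlgebra.contractRight_mul _ (hY x), add_mul]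
  congr 1
  · rw [mul_assoc]
  -- In degree `0` the contraction vanishes. In degree `k + 1` the sign `(-1)^l` of the contraction
  -- and the sign `(-1)^(k l)` of moving the contracted `X` past `Y` combine to `(-1)^((k+1) l)`.
  · rcases k with _ | k
    · rw [ExteriorAlgebra.contractRight_eq_zero (hX x)]
      simp
    · rw [ExteriorAlgebra.mul_comm_of_mem (ExteriorAlgebra.contractRight_mem (hX x) _) (hY x),
        ← mul_assoc ((-1) ^ l), ← pow_add, add_comm l, ← Nat.succ_mul]
      simp only [mul_assoc]

theorem rawInduced_mul_right {k l : ℕ} {X Y : MVF n M} (hX : X ∈ A n M k) (hY : Y ∈ A n M l)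
    (Z : MVF n M) :
    N.rawInduced X (Y * Z) =
      N.rawInduced X Y * Z.1 + (-1) ^ ((k + 1) * l) * (Y.1 * N.rawInduced X Z) := by
  funext x
  simp only [rawInduced, Pi.add_apply, Pi.mul_apply, Pi.pow_apply, Pi.neg_apply, Pi.one_apply,
    Finset.mul_sum, Finset.sum_mul, ← Finset.sum_add_distrib]
  refine Finset.sum_congr rfl fun i _ => ?_
  rw [covDeriv_mul, mul_add, mul_assoc]
  congr 1
  rcases k with _ | k
  · rw [ExteriorAlgebra.contractRight_eq_zero (hX x)]
    simp
  · rw [← mul_assoc,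
      ExteriorAlgebra.mul_comm_of_mem (ExteriorAlgebra.contractRight_mem (hX x) _) (hY x),
      -- The contracted field has degree `k`, so the true sign is `(-1)^(k l)`; the surplus `2 l` is
      -- even.
      show (k + 1 + 1) * l = k * l + 2 * l by ring, pow_add, pow_mul (-1) 2 l]
    simp [mul_assoc]

theorem sum_tensorial {W : Type*} [AddCommGroup W] [Module ℝ W] {T : MVF n M →+ W} {x : M}
    (hT : Tensorial T x) (V : VField n M) :
    T (ofVField V) = ∑ i, (tangentBasis x).coord i (V x) •
      T (ofVField (extVector x (tangentBasis x i))) := by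
  rw [← hT.apply_extend, ofVField_apply]
  conv_lhs => rw [← (tangentBasis x).sum_repr (V x)]
  rw [map_sum, map_sum, map_sum]
  refine Finset.sum_congr rfl fun i _ => ?_
  rw [map_smul, extend_smul, hT, extend_ι]
  rfl

theorem rawInduced_ofVField (V W : VField n M) :
    N.rawInduced (ofVField V) (ofVField W) = (N.toFun (ofVField V) (ofVField W)).1 := by
  funext x
  rw [← leftHom_apply, sum_tensorial (N.tensorial_leftHom _ x)]
  refine Finset.sum_congr rfl fun i _ => ?_
  rw [covDeriv_ofVField, ofVField_apply, Algebra.smul_def]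
  congr 1
  exact CliffordAlgebra.contractRight_ι _ _ _

theorem rawInduced_mem {k l m : ℕ} (hm : m + 1 = k + l) {X Y : MVF n M} (hX : X ∈ A n M k)
    (hY : Y ∈ A n M l) (x : M) : N.rawInduced X Y x ∈ ⋀[ℝ]^m (TangentSpace (𝓡 n) x) := by
  refine Submodule.sum_mem _ fun i _ => ?_
  rcases k with _ | k
  · rw [ExteriorAlgebra.contractRight_eq_zero (hX x), zero_mul]
    exact Submodule.zero_mem _
  · obtain rfl : m = k + l := by omega
    exact ExteriorAlgebra.mul_mem_exteriorPower (ExteriorAlgebra.contractRight_mem (hX x) _)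
      (N.covDeriv_mem _ x hY)

/-- The formula uses bases and extensions chosen separately at each point, so it does not show
smoothness. The product rule reduces to vector fields and functions, where the result is a value of
`N`. -/
theorem isSmooth_rawInduced_ofVField (V : VField n M) (Y : MVF n M) :
    IsSmooth (N.rawInduced (ofVField V) Y) := by
  refine isSmooth_of_eventually_eq fun x => ?_
  obtain ⟨Y', hY', h⟩ := exists_mem_span_eventually_eq Y x
  -- `covDeriv` depends on the germ of `Y`, so equality is needed near every nearby point and not
  -- just at it.
  refine ⟨N.rawInduced (ofVField V) Y', ?_, h.eventually_nhds.mono fun y hy =>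
    Finset.sum_congr rfl fun i _ => by rw [N.covDeriv_eq_of_eventually_eq _ hy]⟩
  clear h
  induction hY' using Submodule.span_induction with
  | mem a ha =>
    obtain ⟨L, rfl⟩ := ha
    induction L with
    | nil =>
      rw [wedge_nil, ← map_one (ofFun n M), rawInduced_ofFun_right,
        ← N.apply_fun 1 _ (ofVField_mem V)]
      exact Subtype.property _
    | cons W L ih =>
      rw [wedge_cons, N.rawInduced_mul_right (ofVField_mem V) (ofVField_mem W),
        rawInduced_ofVField]
      refine isSmooth_add (isSmooth_mul (Subtype.property _) (Subtype.property _)) ?_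
      simpa using isSmooth_mul (Subtype.property (ofVField W)) ih
  | zero =>
    rw [← map_zero (ofFun n M), rawInduced_ofFun_right, ← N.apply_fun 1 _ (ofVField_mem V)]
    exact Subtype.property _
  | add a b _ _ ha hb => rw [rawInduced_add_right]; exact isSmooth_add ha hb
  | smul f a _ ha =>
    rw [rawInduced_smul_right, ← N.apply_fun 1 _ (ofVField_mem V)]
    exact isSmooth_add (isSmooth_mul (Subtype.property _) (Subtype.property _))
      (isSmooth_mul (isSmooth_rawOfFun f.contMDiff) ha)

theorem isSmooth_rawInduced (X Y : MVF n M) : IsSmooth (N.rawInduced X Y) := by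
  refine isSmooth_of_eventually_eq fun x => ?_
  obtain ⟨X', hX', h⟩ := exists_mem_span_eventually_eq X x
  refine ⟨N.rawInduced X' Y, ?_, h.mono fun y hy => by rw [rawInduced, rawInduced, hy]⟩
  clear h
  induction hX' using Submodule.span_induction with
  | mem a ha =>
    obtain ⟨L, rfl⟩ := ha
    induction L with
    | nil =>
      rw [wedge_nil, ← map_one (ofFun n M), rawInduced_ofFun_left]
      exact (MVF n M).zero_mem
    | cons V L ih =>
      rw [wedge_cons, N.rawInduced_mul_left (ofVField_mem V) (wedge_mem L)]
      exact isSmooth_add (isSmooth_mul (Subtype.property _) ih)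
        (isSmooth_mul ((MVF n M).pow_mem ((MVF n M).neg_mem (MVF n M).one_mem) _)
          (isSmooth_mul (Subtype.property _) (N.isSmooth_rawInduced_ofVField V Y)))
  | zero =>
    rw [← map_zero (ofFun n M), rawInduced_ofFun_left]
    exact (MVF n M).zero_mem
  | add a b _ _ ha hb => rw [rawInduced_add_left]; exact isSmooth_add ha hb
  | smul f a _ ha =>
    rw [rawInduced_smul_left]
    exact isSmooth_mul (isSmooth_rawOfFun f.contMDiff) ha

/-- The higher connection induced by the restriction of `N` to vector fields. -/
noncomputable def induced : HigherConnection n M where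
  toFun X Y := ⟨N.rawInduced X Y, N.isSmooth_rawInduced X Y⟩
  degree _ _ _ hm _ hX _ hY := N.rawInduced_mem hm hX hY
  linear_left f X _ Y := Subtype.ext <|
    (N.rawInduced_add_left _ _ _).trans (congrArg (· + _) (N.rawInduced_smul_left f X Y))
  add_right X Y Y' := Subtype.ext (N.rawInduced_add_right X Y Y')
  apply_fun _ X _ f := N.rawInduced_ofFun_right X f
  leibniz _ X _ f Y := N.rawInduced_smul_right X f Y
  fun_left f X := Subtype.ext (N.rawInduced_ofFun_left f X)

theorem isInduced_induced : N.induced.IsInduced := fun _ _ _ hX _ hY Z =>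
  ⟨Subtype.ext (N.rawInduced_mul_left hX hY Z), Subtype.ext (N.rawInduced_mul_right hX hY Z)⟩

theorem induced_ofVField (V W : VField n M) :
    N.induced.toFun (ofVField V) (ofVField W) = N.toFun (ofVField V) (ofVField W) :=
  Subtype.ext (N.rawInduced_ofVField V W)

end Extension

end HigherConnection

/-! ### Vector fields as `A¹(M)`, and restriction to an affine connection -/

theorem ofVField_injective : Function.Injective (ofVField : VField n M → MVF n M) := by
  intro V W h
  ext1 x
  have hx := MVF.ext_iff_apply.1 h x
  rwa [ofVField_apply, ofVField_apply, ExteriorAlgebra.ι_inj] at hx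

/-- The vector field underlying an element of `A¹(M)`. -/
noncomputable def toVField (X : MVF n M) : VField n M :=
  ⟨fun x => ExteriorAlgebra.ιInv (X.1 x), by
    intro x
    refine (Bundle.contMDiffAt_section x).2 ?_
    let b := (EuclideanSpace.basisFun (Fin n) ℝ).toBasis
    have h : ContMDiffAt (𝓡 n) 𝓘(ℝ, Model n) ∞ (fun y =>
        ∑ i, (b.coord i ∘ₗ ExteriorAlgebra.ιInv) (coord X.1 x y) • b i) x :=
      ContMDiffAt.sum fun i _ => (X.2 x (b.coord i ∘ₗ ExteriorAlgebra.ιInv)).smul contMDiffAt_const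
    refine h.congr_of_eventuallyEq ?_
    filter_upwards [triv_baseSet_mem_nhds (mem_triv_baseSet (n := n) x)] with y hy
    rw [← (triv (n := n) x).continuousLinearMapAt_apply_of_mem (R := ℝ) hy]
    simp only [LinearMap.comp_apply, Module.Basis.coord_apply, b.sum_repr, coord]
    exact (DFunLike.congr_fun (ExteriorAlgebra.ιInv_comp_map
      ((triv (n := n) x).continuousLinearMapAt ℝ y).toLinearMap) (X.1 y)).symm⟩

theorem ofVField_toVField {X : MVF n M} (hX : X ∈ A n M 1) : ofVField (toVField X) = X := by
  rw [MVF.ext_iff_apply]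
  intro x
  obtain ⟨v, hv⟩ := exists_ι_eq hX x
  change ExteriorAlgebra.ι ℝ (ExteriorAlgebra.ιInv (X.1 x)) = X.1 x
  rw [← hv, ExteriorAlgebra.ι_leftInverse]

theorem ofVField_add (V W : VField n M) : ofVField (V + W) = ofVField V + ofVField W := by
  rw [MVF.ext_iff_apply]
  intro x
  simp

theorem ofVField_fsmul (f : SmoothFun n M) (V : VField n M) :
    ofVField (fsmul f V) = f • ofVField V := by
  rw [MVF.ext_iff_apply]
  intro x
  rw [smul_apply, ofVField_apply, ofVField_apply, ← map_smul]
  rfl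

theorem ofVField_const_smul (c : ℝ) (V : VField n M) :
    ofVField (c • V) = constFun n M c • ofVField V := by
  rw [← ofVField_fsmul]
  rfl

theorem mem_A_eq_zero {k : ℕ} (hk : n < k) {X : MVF n M} (hX : X ∈ A n M k) : X = 0 := by
  rw [MVF.ext_iff_apply]
  intro x
  have h : Module.finrank ℝ (TangentSpace (𝓡 n) x) < k :=
    (finrank_euclideanSpace_fin (𝕜 := ℝ) (n := n)).trans_lt hk
  have : FiniteDimensional ℝ (TangentSpace (𝓡 n) x) :=
    inferInstanceAs (FiniteDimensional ℝ (Model n))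
  have := hX x
  rw [ExteriorAlgebra.exteriorPower_eq_bot_of_finrank_lt h] at this
  exact this

namespace HigherConnection

variable (N D : HigherConnection n M)

theorem toFun_smul_left (f : SmoothFun n M) (X Y : MVF n M) :
    N.toFun (f • X) Y = f • N.toFun X Y := by
  have h := N.linear_left f X 0 Y
  rwa [add_zero, zero_left, add_zero] at h

theorem toFun_add_left (X X' Y : MVF n M) :
    N.toFun (X + X') Y = N.toFun X Y + N.toFun X' Y := by
  have h := N.linear_left 1 X X' Y
  rwa [one_smul, one_smul] at h

theorem toFun_vField_mem (V W : VField n M) :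
    N.toFun (ofVField V) (ofVField W) ∈ A n M 1 :=
  N.degree 1 1 1 rfl _ (ofVField_mem V) _ (ofVField_mem W)

/-- The affine connection obtained by restricting a higher connection to vector fields. -/
noncomputable def restrict : AffineConnection n M where
  toFun V W := toVField (N.toFun (ofVField V) (ofVField W))
  add_left V V' W := ofVField_injective <| by
    simp only [ofVField_add, ofVField_toVField (toFun_vField_mem _ _ _), ← toFun_add_left]
    rw [← ofVField_add, ofVField_toVField (toFun_vField_mem _ _ _)]
  smul_left f V W := ofVField_injective <| by
    rw [ofVField_toVField (toFun_vField_mem _ _ _), ofVField_fsmul, ofVField_fsmul,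
      ofVField_toVField (toFun_vField_mem _ _ _), toFun_smul_left]
  add_right V W W' := ofVField_injective <| by
    rw [ofVField_toVField (toFun_vField_mem _ _ _), ofVField_add, ofVField_add,
      ofVField_toVField (toFun_vField_mem _ _ _), ofVField_toVField (toFun_vField_mem _ _ _), N.add_right]
  const_smul_right c V W := ofVField_injective <| by
    rw [ofVField_toVField (toFun_vField_mem _ _ _), ofVField_const_smul, ofVField_const_smul,
      ofVField_toVField (toFun_vField_mem _ _ _), MVF.ext_iff_apply]
    intro x
    have h := N.rightHom_smul V x (constFun n M c) (ofVField W)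
    rw [mvfderiv_constFun, _root_.zero_apply, zero_smul, zero_add] at h
    rw [smul_apply]
    exact h
  leibniz f V W x := by
    have h := N.rightHom_smul V x f (ofVField W)
    rw [← ofVField_fsmul] at h
    have h' := congrArg ExteriorAlgebra.ιInv h
    rw [map_add, map_smul, map_smul, ofVField_apply, ExteriorAlgebra.ι_leftInverse] at h'
    exact h'

theorem ofVField_restrict (V W : VField n M) :
    ofVField (N.restrict.toFun V W) = N.toFun (ofVField V) (ofVField W) :=
  ofVField_toVField (N.toFun_vField_mem V W)

theorem tensorial_leftHom_sub (Y : MVF n M) (x : M) :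
    Tensorial (N.leftHom Y x - D.leftHom Y x) x := fun f X => by
  rw [AddMonoidHom.sub_apply, N.tensorial_leftHom, D.tensorial_leftHom, ← smul_sub]
  rfl

/-- The bracket term in the Leibniz rule does not involve the connection, so it cancels. Homogeneity
of `X` is needed for that rule to apply. -/
theorem tensorial_rightHom_sub {k : ℕ} {X : MVF n M} (hX : X ∈ A n M k) (x : M) :
    Tensorial (N.rightHom X x - D.rightHom X x) x := fun f Y => by
  simp only [AddMonoidHom.sub_apply, rightHom_apply]
  have hN := congrFun (N.leibniz k X hX f Y) x
  have hD := congrFun (D.leibniz k X hX f Y) x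
  rw [hN, hD, Pi.add_apply, Pi.add_apply, add_sub_add_left_eq_sub, smul_apply, smul_apply,
    ← smul_sub]

variable {N D} in
theorem toFun_one_right {k : ℕ} {X : MVF n M} (hX : X ∈ A n M k) : N.toFun X 1 = D.toFun X 1 := by
  rw [← map_one (ofFun n M)]
  exact Subtype.ext ((N.apply_fun k X hX 1).trans (D.apply_fun k X hX 1).symm)

variable {N} in
theorem toFun_one_left (Y : MVF n M) : N.toFun 1 Y = 0 := by
  rw [← map_one (ofFun n M), N.fun_left]

/-! ### Comparison of two higher connections -/

section Extension

variable [T2Space M] {N D}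

theorem toFun_eq_of_wedge_right {k : ℕ} {X : MVF n M} (hX : X ∈ A n M k)
    (h : ∀ L, N.toFun X (wedge L) = D.toFun X (wedge L)) (Y : MVF n M) :
    N.toFun X Y = D.toFun X Y := by
  rw [MVF.ext_iff_apply]
  intro x
  refine sub_eq_zero.1 ((tensorial_rightHom_sub N D hX x).eq_zero (fun L => ?_) Y)
  rw [AddMonoidHom.sub_apply, rightHom_apply, rightHom_apply, h, sub_self]

theorem toFun_eq_of_wedge_left {Y : MVF n M}
    (h : ∀ L, N.toFun (wedge L) Y = D.toFun (wedge L) Y) (X : MVF n M) :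
    N.toFun X Y = D.toFun X Y := by
  rw [MVF.ext_iff_apply]
  intro x
  refine sub_eq_zero.1 ((tensorial_leftHom_sub N D Y x).eq_zero (fun L => ?_) X)
  rw [AddMonoidHom.sub_apply, leftHom_apply, leftHom_apply, h, sub_self]

/-- An induced higher connection is determined by its restriction to vector fields. -/
theorem IsInduced.eq_of_vField (hN : N.IsInduced) (hD : D.IsInduced)
    (h : ∀ V W : VField n M,
      N.toFun (ofVField V) (ofVField W) = D.toFun (ofVField V) (ofVField W)) : N = D := by
  -- The rule for `∇_X (Y ∧ Z)` settles a vector field on the left and anything on the right; the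
  -- rule for `∇_{X ∧ Y} Z` then settles the left argument.
  have hV : ∀ V Y, N.toFun (ofVField V) Y = D.toFun (ofVField V) Y := fun V =>
    toFun_eq_of_wedge_right (ofVField_mem V) fun L => by
      induction L with
      | nil => exact toFun_one_right (ofVField_mem V)
      | cons W L ih =>
        rw [wedge_cons, (hN 1 1 _ (ofVField_mem V) _ (ofVField_mem W) _).2,
          (hD 1 1 _ (ofVField_mem V) _ (ofVField_mem W) _).2, ih, h]
  ext1
  funext X Y
  refine toFun_eq_of_wedge_left (fun L => ?_) X
  induction L with
  | nil => rw [wedge_nil, toFun_one_left, toFun_one_left]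
  | cons V L ih =>
    rw [wedge_cons, (hN 1 _ _ (ofVField_mem V) _ (wedge_mem L) _).1,
      (hD 1 _ _ (ofVField_mem V) _ (wedge_mem L) _).1, ih, hV]

/-- Two higher connections agree if they agree in positive degrees. -/
theorem eq_of_homogeneous (h : ∀ k l : ℕ, 0 < k → 0 < l → k + l - 1 ≤ n → ∀ X ∈ A n M k,
    ∀ Y ∈ A n M l, N.toFun X Y = D.toFun X Y) : N = D := by
  ext1
  funext X Y
  refine toFun_eq_of_wedge_left (fun L => ?_) X
  refine toFun_eq_of_wedge_right (wedge_mem L) (fun L' => ?_) Y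
  -- An empty wedge is the function `1`: on the left both connections vanish, on the right both give
  -- the bracket. When `k + l - 1 > n` both values lie in a zero space.
  rcases L with _ | ⟨V, L⟩
  · rw [wedge_nil, toFun_one_left, toFun_one_left]
  rcases L' with _ | ⟨W, L'⟩
  · exact toFun_one_right (wedge_mem _)
  by_cases hn : (V :: L).length + (W :: L').length - 1 ≤ n
  · exact h _ _ (by simp) (by simp) hn _ (wedge_mem _) _ (wedge_mem _)
  · have hm : (V :: L).length + (W :: L').length - 1 + 1 =
      (V :: L).length + (W :: L').length := by simp; omega
    rw [mem_A_eq_zero (not_le.1 hn) (N.degree _ _ _ hm _ (wedge_mem _) _ (wedge_mem _)),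
      mem_A_eq_zero (not_le.1 hn) (D.degree _ _ _ hm _ (wedge_mem _) _ (wedge_mem _))]

variable (N D)

/-- The difference of two higher connections, as a tensor field. -/
noncomputable def diffTensor (k l : ℕ) (hk : 0 < k) : TensorField n M k l (k + l - 1) where
  toFun x := LinearMap.mk₂ ℝ
    (fun ξ η => ⟨(N.toFun (extend x ξ.1) (extend x η.1) -
        D.toFun (extend x ξ.1) (extend x η.1)).1 x,
      Submodule.sub_mem (A n M (k + l - 1))
        (N.degree k l _ (by omega) _ (extend_mem ξ.2) _ (extend_mem η.2))
        (D.degree k l _ (by omega) _ (extend_mem ξ.2) _ (extend_mem η.2)) x⟩)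
    (fun ξ ξ' η => Subtype.ext <| by
      have := map_add (N.leftHom (extend x η.1) x - D.leftHom (extend x η.1) x)
        (extend x ξ.1) (extend x ξ'.1)
      rwa [← map_add] at this)
    (fun c ξ η => Subtype.ext <| by
      have := tensorial_leftHom_sub N D (extend x η.1) x (constFun n M c) (extend x ξ.1)
      rwa [← extend_smul] at this)
    (fun ξ η η' => Subtype.ext <| by
      have := map_add (N.rightHom (extend x ξ.1) x - D.rightHom (extend x ξ.1) x)
        (extend x η.1) (extend x η'.1)
      rwa [← map_add] at this)
    (fun c ξ η => Subtype.ext <| by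
      have := tensorial_rightHom_sub N D (extend_mem ξ.2) x (constFun n M c) (extend x η.1)
      rwa [← extend_smul] at this)
  smooth X Y := by
    -- By tensoriality, first on the left and then on the right, the extensions may be replaced by
    -- `X` and `Y`, leaving a difference of smooth fields.
    refine (congrArg IsSmooth ?_).mpr (N.toFun X.1 Y.1 - D.toFun X.1 Y.1).2
    funext x
    have h1 := (tensorial_leftHom_sub N D (extend x (Y.1.1 x)) x).apply_extend X.1
    have h2 := (tensorial_rightHom_sub N D X.2 x).apply_extend Y.1
    exact h1.trans h2

theorem diffTensor_apply {k l : ℕ} (hk : 0 < k) (X : A n M k) (Y : A n M l) (x : M) :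
    ((N.diffTensor D k l hk).toFun x ⟨X.1.1 x, X.2 x⟩ ⟨Y.1.1 x, Y.2 x⟩ :
      ExteriorAlgebra ℝ (TangentSpace (𝓡 n) x)) =
        (N.toFun X Y).1 x - (D.toFun X Y).1 x := by
  have h1 := (tensorial_leftHom_sub N D (extend x (Y.1.1 x)) x).apply_extend X.1
  have h2 := (tensorial_rightHom_sub N D X.2 x).apply_extend Y.1
  exact h1.trans h2

end Extension

end HigherConnection

/-! ### The associated pair: existence, uniqueness, criterion -/

section Association

variable {N : HigherConnection n M}

open HigherConnection

theorem IsAssociated.conn_apply {d : ConnectionData n M} (hd : IsAssociated N d)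
    (V W : VField n M) :
    ofVField (d.conn.toFun V W) = N.toFun (ofVField V) (ofVField W) := by
  obtain ⟨D, ⟨-, hD⟩, h⟩ := hd
  rw [← hD, MVF.ext_iff_apply]
  intro x
  -- The index `(1, 1)` occurs only if `1 ≤ n`; for `n = 0` every element of `A¹(M)` is zero.
  rcases Nat.eq_zero_or_pos n with rfl | hn
  · rw [mem_A_eq_zero one_pos (D.toFun_vField_mem V W),
      mem_A_eq_zero one_pos (N.toFun_vField_mem V W)]
  · have h11 := h 1 1 one_pos one_pos hn ⟨_, ofVField_mem V⟩ ⟨_, ofVField_mem W⟩ x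
    rw [d.twist_one_one] at h11
    rw [h11]
    simp

variable [T2Space M]

/-- A tensor field is determined by its values on multivector fields. -/
theorem TensorField.ext_apply {k l m : ℕ} {F G : TensorField n M k l m}
    (h : ∀ (X : A n M k) (Y : A n M l) (x : M),
      (F.toFun x ⟨X.1.1 x, X.2 x⟩ ⟨Y.1.1 x, Y.2 x⟩ : ExteriorAlgebra ℝ (TangentSpace (𝓡 n) x)) =
        G.toFun x ⟨X.1.1 x, X.2 x⟩ ⟨Y.1.1 x, Y.2 x⟩) : F = G := by
  ext1
  funext x
  refine LinearMap.ext fun ξ => LinearMap.ext fun η => Subtype.ext ?_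
  have hx := h ⟨_, extend_mem ξ.2⟩ ⟨_, extend_mem η.2⟩ x
  have hξ : (⟨(extend x ξ.1).1 x, extend_mem ξ.2 x⟩ : ⋀[ℝ]^k (TangentSpace (𝓡 n) x)) = ξ :=
    Subtype.ext (extend_self x ξ.1)
  have hη : (⟨(extend x η.1).1 x, extend_mem η.2 x⟩ : ⋀[ℝ]^l (TangentSpace (𝓡 n) x)) = η :=
    Subtype.ext (extend_self x η.1)
  rwa [hξ, hη] at hx

/-- This pins the existentially quantified connection in `IsAssociated` to one that depends on `N`
alone, so the twists can only be `N - N.induced`. -/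
theorem IsAssociated.isInducedBy_eq {d : ConnectionData n M} (hd : IsAssociated N d)
    {D : HigherConnection n M} (hD : IsInducedBy D d.conn) : D = N.induced :=
  hD.1.eq_of_vField N.isInduced_induced fun V W => by
    rw [hD.2, hd.conn_apply, N.induced_ofVField]

theorem IsAssociated.twist_apply {d : ConnectionData n M} (hd : IsAssociated N d)
    (k l : ℕ) (hk : 0 < k) (hl : 0 < l) (hkl : k + l - 1 ≤ n)
    (X : A n M k) (Y : A n M l) (x : M) :
    ((d.twist k l hk hl hkl).toFun x ⟨X.1.1 x, X.2 x⟩ ⟨Y.1.1 x, Y.2 x⟩ :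
      ExteriorAlgebra ℝ (TangentSpace (𝓡 n) x)) =
        (N.toFun X Y).1 x - (N.induced.toFun X Y).1 x := by
  obtain ⟨D, hD, h⟩ := id hd
  obtain rfl := hd.isInducedBy_eq hD
  rw [h k l hk hl hkl, add_sub_cancel_left]

variable (N)

/-- The pair associated to a higher connection. -/
noncomputable def connectionData : ConnectionData n M where
  conn := N.restrict
  twist k l hk _ _ := N.diffTensor N.induced k l hk
  twist_one_one _ x := by
    refine LinearMap.ext fun ξ => LinearMap.ext fun η => Subtype.ext ?_
    -- Elements of `⋀¹` are vectors and extend to vector fields, on which `N` and `N.induced` agree.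
    obtain ⟨v, hv⟩ := exists_ι_eq (extend_mem ξ.2) x
    obtain ⟨w, hw⟩ := exists_ι_eq (extend_mem η.2) x
    rw [extend_self] at hv hw
    change (N.toFun (extend x ξ.1) (extend x η.1) -
      N.induced.toFun (extend x ξ.1) (extend x η.1)).1 x = 0
    rw [← hv, ← hw, extend_ι, extend_ι, N.induced_ofVField, sub_self]
    rfl

theorem isAssociated_connectionData : IsAssociated N (connectionData N) :=
  ⟨N.induced, ⟨N.isInduced_induced, fun V W => by
      rw [N.induced_ofVField]; exact (N.ofVField_restrict V W).symm⟩,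
    fun k l hk hl hkl X Y x => by
      rw [show (connectionData N).twist k l hk hl hkl = N.diffTensor N.induced k l hk from rfl,
        diffTensor_apply, add_sub_cancel]⟩

variable {N}

theorem IsAssociated.unique {d d' : ConnectionData n M} (hd : IsAssociated N d)
    (hd' : IsAssociated N d') : d = d' := by
  ext1
  · ext1
    funext V W
    exact ofVField_injective ((hd.conn_apply V W).trans (hd'.conn_apply V W).symm)
  · funext k l hk hl hkl
    exact TensorField.ext_apply fun X Y x =>
      (hd.twist_apply k l hk hl hkl X Y x).trans (hd'.twist_apply k l hk hl hkl X Y x).symm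

theorem IsAssociated.isInduced_iff {d : ConnectionData n M} (hd : IsAssociated N d) :
    N.IsInduced ↔ ∀ (k l : ℕ) (hk : 0 < k) (hl : 0 < l) (hkl : k + l - 1 ≤ n) (x : M),
      (d.twist k l hk hl hkl).toFun x = 0 := by
  constructor
  · intro hN k l hk hl hkl x
    have h : N = N.induced := hN.eq_of_vField N.isInduced_induced fun V W =>
      (N.induced_ofVField V W).symm
    let Z : TensorField n M k l (k + l - 1) := ⟨fun _ => 0, fun _ _ => (MVF n M).zero_mem⟩
    have hZ : d.twist k l hk hl hkl = Z := TensorField.ext_apply fun X Y x => by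
      rw [hd.twist_apply, ← h, sub_self]; rfl
    rw [hZ]
  · intro h
    have hN : N = N.induced := eq_of_homogeneous fun k l hk hl hkl X hX Y hY => by
      rw [MVF.ext_iff_apply]
      intro x
      have hx := hd.twist_apply k l hk hl hkl ⟨X, hX⟩ ⟨Y, hY⟩ x
      rw [h] at hx
      exact sub_eq_zero.1 hx.symm
    rw [hN]
    exact N.isInduced_induced

end Association

end HigherConn

theorem mainTheorem3 (n : ℕ) (M : Type*) [TopologicalSpace M] [T2Space M]
    [SecondCountableTopology M] [ChartedSpace (HigherConn.Model n) M] [IsManifold (𝓡 n) ∞ M]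
    (N : HigherConn.HigherConnection n M) :
    (∃! d : HigherConn.ConnectionData n M, HigherConn.IsAssociated N d) ∧
    ∀ d : HigherConn.ConnectionData n M, HigherConn.IsAssociated N d →
      (N.IsInduced ↔ ∀ (k l : ℕ) (hk : 0 < k) (hl : 0 < l) (hkl : k + l - 1 ≤ n) (x : M),
        (d.twist k l hk hl hkl).toFun x = 0) :=
  ⟨⟨_, HigherConn.isAssociated_connectionData N, fun _ hd =>
    hd.unique (HigherConn.isAssociated_connectionData N)⟩, fun _ hd => hd.isInduced_iff⟩
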